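/- **Theorem (consistency of $\hat\beta$ for fixed $n'$).** Let $(X_i,Z_i)_{i\ge 1}$ be i.i.d. with $X_i=(X_{i,1},X_{i,2})\in\mathbb R^2$ and $Z_i\in\mathbb R^p$. Suppose $Z_i$ has Lebesgue density $f_Z$, and let $\kappa_z$ be a version of the conditional law of $X_1$ given $Z_1=z$ whose two margins are continuous (atomless) for every $z$. Put $$\tau(z_1,z_2):=\mathbb P\big((X_{1,1}-X_{2,1})(X_{1,2}-X_{2,2})>0\mid Z_1=z_1,Z_2=z_2\big)-\mathbb P\big((X_{1,1}-X_{2,1})(X_{1,2}-X_{2,2})<0\mid Z_1=z_1,Z_2=z_2\big),$$ the conditional probabilities being computed under $\kappa_{z_1}\otimes\kappa_{z_2}$; $\tau_{1,2|Z=z}:=\tau(z,z)$ is the conditional Kendall's tau. Let $\mathcal Z\subset\mathbb R^p$ be compact, with $f_Z$ bounded below on $\mathcal Z$ by a positive constant. Assume that, at every $z\in\mathcal Z$, $f_Z$ is continuous (as a function on $\mathbb R^p$) and $(z_1,z_2)\mapsto\tau(z_1,z_2)$ is continuous at $(z,z)$ (as a function on $\mathbb R^p\times\mathbb R^p$). Let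 $K:\mathbb R^p\to\mathbb R$ be a bounded, symmetric, integrable kernel with $\int K=1$, of order $\alpha$ for some integer $\alpha>1$ (all moments of orders $1,\dots,\alpha-1$ exist and vanish), and such that $K(t)|t|^p\to0$ as $|t|\to\infty$. Let $h_n>0$ with $h_n\to 0$ and $nh_n^p\to\infty$, and $K_h(u)=h^{-p}K(u/h)$. Let $g^*$ be one of $g_1(x,y)=4\cdot\mathbf 1\{x_1<y_1,x_2<y_2\}-1$, $g_2(x,y)=\mathbf 1\{(x_1-y_1)(x_2-y_2)>0\}-\mathbf 1\{(x_1-y_1)(x_2-y_2)<0\}$, $g_3(x,y)=1-4\cdot\mathbf 1\{x_1<y_1,x_2>y_2\}$, and $$\hat\tau_{1,2|Z=z}:=\sum_{i,j=1}^n w_{i,n}(z)w_{j,n}(z)\,g^*(X_i,X_j),\qquad w_{i,n}(z)=\frac{K_{h_n}(Z_i-z)}{\sum_{j=1}^nK_{h_n}(Z_j-z)}$$ (with the convention that a quotient with denominator $0$ is $0$). Let $\Lambda$ be a strictly increasing, continuously differentiable real function on a set $D$ with $(-1,1)\subseteq D\subseteq[-1,1]$, let $\psi:\mathbb R^p\to\mathbb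 R^{p'}$ and $\beta^*\in\mathbb R^{p'}$, and suppose that $\tau_{1,2|Z=z}\in D$ and $\Lambda(\tau_{1,2|Z=z})=\psi(z)^T\beta^*$ for all $z\in\mathcal Z$. Fix $n'\ge1$ and (deterministic) design points $z'_1,\dots,z'_{n'}\in\mathcal Z$. Let $\lambda_{n,n'}\ge0$ with $\lambda_{n,n'}\to\lambda_0$ as $n\to\infty$, and for each $n$ let $\hat\beta_{n,n'}$ be any minimizer over $\beta\in\mathbb R^{p'}$ of $$\frac1{n'}\sum_{i=1}^{n'}\Big(\Lambda\big(\hat\tau_{1,2|Z=z'_i}\big)-\psi(z'_i)^T\beta\Big)^2+\lambda_{n,n'}|\beta|_1,$$ where $\hat\tau$ is truncated to $[-1,1]$ before $\Lambda$ is applied (and $\Lambda$ is given arbitrary values at those endpoints $\pm1$ that are not in $D$). Put $$\mathbb G_{\infty,n'}(\beta):=\frac1{n'}\sum_{i=1}^{n'}\big(\psi(z'_i)^T(\beta^*-\beta)\big)^2+\lambda_0|\beta|_1.$$ 1. If $\mathbb G_{\infty,n'}$ has a unique minimizer $\beta^{**}$, then $\hat\beta_{n,n'}\to\beta^{**}$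 in probability as $n\to\infty$. 2. If $\lambda_0=0$ and $\psi(z'_1),\dots,\psi(z'_{n'})$ span $\mathbb R^{p'}$, then $\beta^*$ is the unique minimizer of $\mathbb G_{\infty,n'}$, and $\hat\beta_{n,n'}\to\beta^*$ in probability as $n\to\infty$. -/

import Mathlib

open MeasureTheory ProbabilityTheory Filter Topology Set
open scoped ENNReal

/-- The covariate space `ℝ^p` with its Euclidean norm and Lebesgue measure. -/
abbrev Cov (p : ℕ) : Type := EuclideanSpace ℝ (Fin p)

/-- Pairs of observations `((x₁,x₂),(y₁,y₂))` of the bivariate variable that are concordant. -/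
def concordantSet : Set ((ℝ × ℝ) × (ℝ × ℝ)) :=
  {q | 0 < (q.1.1 - q.2.1) * (q.1.2 - q.2.2)}

/-- Pairs of observations that are discordant. -/
def discordantSet : Set ((ℝ × ℝ) × (ℝ × ℝ)) :=
  {q | (q.1.1 - q.2.1) * (q.1.2 - q.2.2) < 0}

/-- `P(concordance | Z₁ = z₁, Z₂ = z₂) - P(discordance | Z₁ = z₁, Z₂ = z₂)` for two independent
copies of `(X, Z)`, where `κ z` is the conditional law of `X` given `Z = z`. -/
noncomputable def condTauPair {p : ℕ} (κ : Kernel (Cov p) (ℝ × ℝ)) (z₁ z₂ : Cov p) : ℝ :=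
  ((κ z₁).prod (κ z₂)).real concordantSet - ((κ z₁).prod (κ z₂)).real discordantSet

/-- The conditional Kendall's tau `τ_{1,2|Z=z}`. -/
noncomputable def condKendallTau {p : ℕ} (κ : Kernel (Cov p) (ℝ × ℝ)) (z : Cov p) : ℝ :=
  condTauPair κ z z

noncomputable def gOne (x y : ℝ × ℝ) : ℝ :=
  4 * (if x.1 < y.1 ∧ x.2 < y.2 then 1 else 0) - 1

noncomputable def gTwo (x y : ℝ × ℝ) : ℝ :=
  (if 0 < (x.1 - y.1) * (x.2 - y.2) then 1 else 0)
    - (if (x.1 - y.1) * (x.2 - y.2) < 0 then 1 else 0)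

noncomputable def gThree (x y : ℝ × ℝ) : ℝ :=
  1 - 4 * (if x.1 < y.1 ∧ y.2 < x.2 then 1 else 0)

/-- `K` is a bounded, symmetric, integrable kernel on `ℝ^p` with integral one, and of order `α`:
all its moments of order `1, …, α - 1` exist and vanish. -/
structure IsKernelOfOrder {p : ℕ} (K : Cov p → ℝ) (α : ℕ) : Prop where
  bounded : ∃ C : ℝ, ∀ u, |K u| ≤ C
  symmetric : ∀ u, K (-u) = K u
  integrable : Integrable K
  integral_eq_one : ∫ u, K u = 1
  moment_integrable : ∀ j : ℕ, 1 ≤ j → j < α → ∀ ι : Fin j → Fin p,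
    Integrable (fun u : Cov p => K u * ∏ l, u (ι l))
  moment_eq_zero : ∀ j : ℕ, 1 ≤ j → j < α → ∀ ι : Fin j → Fin p,
    ∫ u : Cov p, K u * ∏ l, u (ι l) = 0

/-- The rescaled kernel `K_h(u) = h^{-p} K(u / h)`. -/
noncomputable def scaledKernel {p : ℕ} (K : Cov p → ℝ) (h : ℝ) (u : Cov p) : ℝ :=
  (h ^ p)⁻¹ * K (h⁻¹ • u)

/-- The weight `w_{i,n}(z) = K_h(Z_i - z) / ∑_{j < n} K_h(Z_j - z)` for covariate values `Z`. -/
noncomputable def kernelWeight {p : ℕ} (K : Cov p → ℝ) (h : ℝ) (n : ℕ) (Z : ℕ → Cov p)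
    (z : Cov p) (i : ℕ) : ℝ :=
  scaledKernel K h (Z i - z) / ∑ j ∈ Finset.range n, scaledKernel K h (Z j - z)

/-- The kernel estimator `∑_{i,j} w_{i,n}(z) w_{j,n}(z) g(X_i, X_j)` of the conditional Kendall's
tau, computed from the first `n` observations. -/
noncomputable def tauHat {p : ℕ} (K : Cov p → ℝ) (h : ℝ) (g : ℝ × ℝ → ℝ × ℝ → ℝ) (n : ℕ)
    (Z : ℕ → Cov p) (X : ℕ → ℝ × ℝ) (z : Cov p) : ℝ :=
  ∑ i ∈ Finset.range n, ∑ j ∈ Finset.range n,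
    kernelWeight K h n Z z i * kernelWeight K h n Z z j * g (X i) (X j)

/-- Truncation to `[-1, 1]`. -/
noncomputable def truncUnit (t : ℝ) : ℝ := max (-1) (min 1 t)

/-- The `ℓ¹` norm on `ℝ^{p'}`. -/
def l1norm {p' : ℕ} (β : Fin p' → ℝ) : ℝ := ∑ j, |β j|

/-- The penalised least squares criterion
`(1/n') ∑_i (Y_i - ψ(z'_i)ᵀ β)² + lam |β|₁`. -/
noncomputable def lassoCriterion {p p' n' : ℕ} (ψ : Cov p → Fin p' → ℝ) (z' : Fin n' → Cov p)
    (Y : Fin n' → ℝ) (lam : ℝ) (β : Fin p' → ℝ) : ℝ :=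
  1 / (n' : ℝ) * ∑ i, (Y i - ψ (z' i) ⬝ᵥ β) ^ 2 + lam * l1norm β

/-- The limiting criterion `(1/n') ∑_i (ψ(z'_i)ᵀ (β* - β))² + lam₀ |β|₁`. -/
noncomputable def limitCriterion {p p' n' : ℕ} (ψ : Cov p → Fin p' → ℝ) (z' : Fin n' → Cov p)
    (βstar : Fin p' → ℝ) (lam₀ : ℝ) (β : Fin p' → ℝ) : ℝ :=
  1 / (n' : ℝ) * ∑ i, (ψ (z' i) ⬝ᵥ (βstar - β)) ^ 2 + lam₀ * l1norm β

/-! The responses at the finitely many design points converge in probability, and the minimiser of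
the convex lasso criterion, where it is unique, depends continuously on the responses and the
penalty level. The theorem composes these two facts.

Responses. After division by `n ^ 2`, the estimator is a weighted V-statistic over the square of the
kernel density estimator. The weights are symmetric in `(i, j)`, so `g` may be replaced by its
symmetrisation, which off ties is the concordance sign for all three choices. After centring at the
value of tau (`tauHat_eq_div`), it remains to show that the centred double sum tends to `0` and that
the density estimator tends to `fZ z > 0`. Both are proved in `L¹`. The V-statistic splits into
degenerate rows, a linear part, the diagonal and a counting correction
(`integral_abs_vStatistic_sub_le`); each part is bounded through the first absolute moment of the
localised kernel, which stays bounded, and its second moment, which is `o(n)` because `n * h n ^ p`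
diverges. The mean of the double sum integrates `condTauPair κ u v - condKendallTau κ z` against
localised weights, and vanishes in the limit by continuity at the diagonal and concentration of the
kernel (`tendsto_integral_localKernel_condTau`). The kernel is signed, so these estimates use
absolute values.

Minimisers. On a small sphere around the unique limiting minimiser the criterion strictly exceeds
its value at the centre. By compactness this survives small perturbations of the data, and by
convexity no minimiser can then lie on or outside the sphere
(`eventually_dist_lt_of_isMinOn_lassoCriterion`). Without penalty, a spanning design makes the
limiting quadratic form definite, hence the minimiser unique. -/

/-! ### Moments of sums of i.i.d. bounded variables -/

section IIDSums

variable {Ω 𝒲 : Type*} [MeasurableSpace Ω] [MeasurableSpace 𝒲] {P : Measure Ω}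
  [IsProbabilityMeasure P] {μ : Measure 𝒲} {W : ℕ → Ω → 𝒲}

theorem integrable_of_abs_le [IsFiniteMeasure μ] {f : 𝒲 → ℝ} (hf : Measurable f) {C : ℝ} (hC : ∀ w, |f w| ≤ C) :
    Integrable f μ :=
  Integrable.of_bound hf.aestronglyMeasurable C (ae_of_all _ hC)

/-- The `L¹` norm of a bounded random variable is at most its `L²` norm. -/
theorem integral_abs_le_sqrt_integral_sq {Y : Ω → ℝ} (hY : MemLp Y 2 P) :
    ∫ ω, |Y ω| ∂P ≤ √(∫ ω, Y ω ^ 2 ∂P) := by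
  apply Real.le_sqrt_of_sq_le
  -- Nonnegativity of the variance of `|Y|` is the squared form of the claim.
  have h1 := variance_nonneg (fun ω => |Y ω|) P
  rw [variance_eq_sub (X := fun ω => |Y ω|) hY.abs] at h1
  simp only [Pi.pow_apply, sq_abs] at h1
  linarith

/-- The mean absolute deviation of a sum of i.i.d. bounded variables. -/
theorem integral_abs_sum_sub_le (hW : ∀ i, Measurable (W i)) (h_indep : iIndepFun W P)
    (h_law : ∀ i, P.map (W i) = μ) {φ : 𝒲 → ℝ} (hφ : Measurable φ) {C : ℝ}
    (hC : ∀ w, |φ w| ≤ C) (s : Finset ℕ) :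
    ∫ ω, |∑ i ∈ s, (φ (W i ω) - ∫ w, φ w ∂μ)| ∂P ≤ √(s.card * ∫ w, φ w ^ 2 ∂μ) := by
  have hmem : ∀ i, MemLp (fun ω => φ (W i ω)) 2 P := fun i =>
    MemLp.of_bound (hφ.comp (hW i)).aestronglyMeasurable C (ae_of_all _ fun ω => hC _)
  have hmean : ∀ i, ∫ ω, φ (W i ω) ∂P = ∫ w, φ w ∂μ := fun i => by
    rw [← h_law i, integral_map (hW i).aemeasurable hφ.aestronglyMeasurable]
  have hsq : ∀ i, ∫ ω, φ (W i ω) ^ 2 ∂P = ∫ w, φ w ^ 2 ∂μ := fun i => by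
    rw [← h_law i, integral_map (hW i).aemeasurable (hφ.pow_const 2).aestronglyMeasurable]
  have hmemsum : MemLp (fun ω => ∑ i ∈ s, (φ (W i ω) - ∫ w, φ w ∂μ)) 2 P :=
    memLp_finsetSum s fun i _ => (hmem i).sub (memLp_const _)
  refine (integral_abs_le_sqrt_integral_sq hmemsum).trans (Real.sqrt_le_sqrt ?_)
  have hvar : Var[∑ i ∈ s, fun ω => φ (W i ω); P] = ∑ i ∈ s, Var[fun ω => φ (W i ω); P] :=
    IndepFun.variance_sum (fun i _ => hmem i) fun i _ j _ hij =>
      (h_indep.indepFun hij).comp hφ hφ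
  have hvar_le : ∀ i, Var[fun ω => φ (W i ω); P] ≤ ∫ w, φ w ^ 2 ∂μ := fun i => by
    rw [← hsq i]
    exact variance_le_expectation_sq (hmem i).aestronglyMeasurable
  have hint : ∀ i ∈ s, Integrable (fun ω => φ (W i ω)) P := fun i _ =>
    (hmem i).integrable (by norm_num)
  have hE : ∫ ω, (∑ i ∈ s, fun ω => φ (W i ω)) ω ∂P = ∑ i ∈ s, ∫ w, φ w ∂μ := by
    simp only [Finset.sum_apply]
    rw [integral_finsetSum s hint]
    exact Finset.sum_congr rfl fun i _ => hmean i
  have hsum : Var[∑ i ∈ s, fun ω => φ (W i ω); P] =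
      ∫ ω, (∑ i ∈ s, (φ (W i ω) - ∫ w, φ w ∂μ)) ^ 2 ∂P := by
    rw [variance_eq_integral (memLp_finsetSum' s fun i _ => hmem i).aestronglyMeasurable.aemeasurable,
      hE]
    simp only [Finset.sum_apply, Finset.sum_sub_distrib]
  rw [← hsum, hvar]
  exact (Finset.sum_le_sum fun i _ => hvar_le i).trans (by simp)

/-- A variable and a finite family of others, independent of it, integrate iteratively. -/
theorem integral_indep_tuple [IsProbabilityMeasure μ] (hW : ∀ i, Measurable (W i)) (h_indep : iIndepFun W P)
    (h_law : ∀ i, P.map (W i) = μ) (i : ℕ) (s : Finset ℕ) (hi : i ∉ s)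
    {F : 𝒲 → (s → 𝒲) → ℝ} (hF : Measurable (Function.uncurry F)) {C : ℝ}
    (hC : ∀ w v, |F w v| ≤ C) :
    ∫ ω, F (W i ω) (fun j => W j ω) ∂P = ∫ w, ∫ ω, F w (fun j => W j ω) ∂P ∂μ := by
  have hV : Measurable fun ω => fun j : s => W j ω := measurable_pi_lambda _ fun j => hW j
  have hind : IndepFun (W i) (fun ω => fun j : s => W j ω) P := by
    have := h_indep.indepFun_finset {i} s (by simpa using hi) hW
    -- The independence lemma speaks of a tuple indexed by the singleton `{i}`; evaluating at its
    -- only index recovers `W i`.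
    exact this.comp (φ := fun a : ({i} : Finset ℕ) → 𝒲 => a ⟨i, by simp⟩) (ψ := id)
      (measurable_pi_apply _) measurable_id
  have hmap := hind.map_prod_eq_prod_map_map (hW i).aemeasurable hV.aemeasurable
  rw [h_law i] at hmap
  have : IsProbabilityMeasure (P.map fun ω => fun j : s => W j ω) :=
    Measure.isProbabilityMeasure_map hV.aemeasurable
  calc ∫ ω, F (W i ω) (fun j => W j ω) ∂P
      = ∫ q, Function.uncurry F q ∂(P.map fun ω => (W i ω, fun j : s => W j ω)) := by
        rw [integral_map ((hW i).prodMk hV).aemeasurable hF.aestronglyMeasurable]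
        rfl
    _ = ∫ w, ∫ v, F w v ∂(P.map fun ω => fun j : s => W j ω) ∂μ := by
        rw [hmap, integral_prod _ (integrable_of_abs_le hF fun q => hC q.1 q.2)]
        rfl
    _ = _ := by
        congr 1 with w
        rw [integral_map hV.aemeasurable]
        exact (hF.comp measurable_prodMk_left).aestronglyMeasurable

end IIDSums

/-! ### Weighted V-statistics -/

section UStatistic

variable {Ω 𝒲 : Type*} [MeasurableSpace Ω] [MeasurableSpace 𝒲] {P : Measure Ω}
  [IsProbabilityMeasure P] {μ : Measure 𝒲} [IsProbabilityMeasure μ] {W : ℕ → Ω → 𝒲}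

theorem abs_integral_mul_le {k : 𝒲 → ℝ} (hk : Measurable k) {C : ℝ} (hC : ∀ w, |k w| ≤ C)
    {q : 𝒲 → ℝ} {B : ℝ} (hB : ∀ w, |q w| ≤ B) :
    |∫ w, k w * q w ∂μ| ≤ B * ∫ w, |k w| ∂μ := by
  rw [← integral_const_mul, ← Real.norm_eq_abs]
  refine norm_integral_le_of_norm_le
    (((integrable_of_abs_le hk hC).abs).const_mul B) (ae_of_all _ fun w => ?_)
  rw [Real.norm_eq_abs, abs_mul, mul_comm]
  exact mul_le_mul_of_nonneg_right (hB w) (abs_nonneg _)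

theorem integral_sq_mul_le {k : 𝒲 → ℝ} (hk : Measurable k) {C : ℝ} (hC : ∀ w, |k w| ≤ C)
    {q : 𝒲 → ℝ} {B : ℝ} (hB : ∀ w, |q w| ≤ B) :
    ∫ w, (k w * q w) ^ 2 ∂μ ≤ B ^ 2 * ∫ w, k w ^ 2 ∂μ := by
  rw [← integral_const_mul]
  have hint : Integrable (fun w => k w ^ 2) μ :=
    integrable_of_abs_le (hk.pow_const 2) (C := C ^ 2) fun w => by
      rw [abs_pow]; exact pow_le_pow_left₀ (abs_nonneg _) (hC w) 2
  refine integral_mono_of_nonneg (ae_of_all _ fun w => sq_nonneg _) (hint.const_mul _)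
    (ae_of_all _ fun w => ?_)
  have : q w ^ 2 ≤ B ^ 2 := sq_le_sq' (neg_le_of_abs_le (hB w)) (le_of_abs_le (hB w))
  simp only [mul_pow]
  nlinarith [mul_le_mul_of_nonneg_right this (sq_nonneg (k w))]

/-- The degenerate part of the row of index `i` of a weighted `V`-statistic. -/
theorem integral_abs_mul_row_sub_le (hW : ∀ i, Measurable (W i)) (h_indep : iIndepFun W P)
    (h_law : ∀ i, P.map (W i) = μ) {k : 𝒲 → ℝ} (hk : Measurable k) {C : ℝ}
    (hC : ∀ w, |k w| ≤ C) {G : 𝒲 → 𝒲 → ℝ} (hG : Measurable (Function.uncurry G)) {B : ℝ}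
    (hB : ∀ w w', |G w w'| ≤ B) (i : ℕ) (s : Finset ℕ) (hi : i ∉ s) :
    ∫ ω, |k (W i ω) * ∑ j ∈ s, (k (W j ω) * G (W i ω) (W j ω) -
        ∫ w, k w * G (W i ω) w ∂μ)| ∂P ≤
      (∫ w, |k w| ∂μ) * √(s.card * (B ^ 2 * ∫ w, k w ^ 2 ∂μ)) := by
  have hGw : ∀ w, Measurable (G w) := fun w => hG.comp measurable_prodMk_left
  have hm : Measurable fun w => ∫ w', k w' * G w w' ∂μ := by
    have : StronglyMeasurable (Function.uncurry fun w w' => k w' * G w w') :=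
      ((hk.comp measurable_snd).mul hG).stronglyMeasurable
    exact this.integral_prod_right.measurable
  have hC0 : 0 ≤ C := (abs_nonneg _).trans (hC (W 0 (nonempty_of_isProbabilityMeasure P).some))
  have hφ : ∀ w w', |k w' * G w w'| ≤ C * B := fun w w' => by
    rw [abs_mul]; exact mul_le_mul (hC _) (hB _ _) (abs_nonneg _) hC0
  have hmC : ∀ w, |∫ w', k w' * G w w' ∂μ| ≤ C * B := fun w => by
    simpa using norm_integral_le_of_norm_le_const (μ := μ)
      (ae_of_all _ (hφ w) : ∀ᵐ w' ∂μ, ‖k w' * G w w'‖ ≤ C * B)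
  -- The row is written as a function of `W i` and of the tuple of the others, so that `W i` can be
  -- frozen at `w`; the sum is then one of i.i.d. centred variables.
  let F : 𝒲 → (s → 𝒲) → ℝ := fun w v =>
    |k w * ∑ j, (k (v j) * G w (v j) - ∫ w', k w' * G w w' ∂μ)|
  have hF : Measurable (Function.uncurry F) := by
    have h1 : ∀ j : s, Measurable fun q : 𝒲 × (s → 𝒲) => q.2 j := fun j =>
      (measurable_pi_apply j).comp measurable_snd
    refine ((hk.comp measurable_fst).mul (Finset.measurable_sum _ fun j _ => ?_)).abs
    exact ((hk.comp (h1 j)).mul (hG.comp (measurable_fst.prodMk (h1 j)))).sub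
      (hm.comp measurable_fst)
  have hFC : ∀ w v, |F w v| ≤ C * ∑ _j : s, (C * B + C * B) := fun w v => by
    simp only [F, abs_abs]
    rw [abs_mul]
    refine mul_le_mul (hC _) ?_ (abs_nonneg _) hC0
    refine (Finset.abs_sum_le_sum_abs _ _).trans (Finset.sum_le_sum fun j _ => ?_)
    exact (abs_sub _ _).trans (add_le_add (hφ _ _) (hmC _))
  have key := integral_indep_tuple hW h_indep h_law i s hi hF hFC
  have hconv : ∀ (w : 𝒲) (ω : Ω), F w (fun j => W j ω) =
      |k w * ∑ j ∈ s, (k (W j ω) * G w (W j ω) - ∫ w', k w' * G w w' ∂μ)| := fun w ω => by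
    simp only [F]
    rw [← Finset.sum_coe_sort s]
  simp only [hconv] at key
  rw [key, ← integral_mul_const]
  refine integral_mono_of_nonneg (ae_of_all _ fun w => integral_nonneg fun _ => abs_nonneg _)
    ((integrable_of_abs_le hk hC).abs.mul_const _) (ae_of_all _ fun w => ?_)
  simp only [abs_mul (k w), integral_const_mul]
  refine mul_le_mul_of_nonneg_left ?_ (abs_nonneg _)
  refine (integral_abs_sum_sub_le hW h_indep h_law (hk.mul (hGw w)) (hφ w) s).trans
    (Real.sqrt_le_sqrt (mul_le_mul_of_nonneg_left ?_ (Nat.cast_nonneg _)))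
  exact integral_sq_mul_le hk hC (hB w)

/-- The mean absolute deviation of a weighted `V`-statistic. -/
theorem integral_abs_vStatistic_sub_le (hW : ∀ i, Measurable (W i)) (h_indep : iIndepFun W P)
    (h_law : ∀ i, P.map (W i) = μ) {k : 𝒲 → ℝ} (hk : Measurable k) {C : ℝ}
    (hC : ∀ w, |k w| ≤ C) {G : 𝒲 → 𝒲 → ℝ} (hG : Measurable (Function.uncurry G)) {B : ℝ}
    (hB : ∀ w w', |G w w'| ≤ B) (n : ℕ) :
    ∫ ω, |∑ i ∈ Finset.range n, ∑ j ∈ Finset.range n,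
          k (W i ω) * k (W j ω) * G (W i ω) (W j ω) -
        n ^ 2 * ∫ w, k w * ∫ w', k w' * G w w' ∂μ ∂μ| ∂P ≤
      n * ((∫ w, |k w| ∂μ) * √(n * (B ^ 2 * ∫ w, k w ^ 2 ∂μ)))
      + n * √(n * ((B * ∫ w, |k w| ∂μ) ^ 2 * ∫ w, k w ^ 2 ∂μ))
      + n * (B * ∫ w, k w ^ 2 ∂μ)
      + n * ((B * ∫ w, |k w| ∂μ) * ∫ w, |k w| ∂μ) := by
  set A := ∫ w, |k w| ∂μ with hA
  set S := ∫ w, k w ^ 2 ∂μ with hS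
  set m : 𝒲 → ℝ := fun w => ∫ w', k w' * G w w' ∂μ with hm_def
  set θ := ∫ w, k w * m w ∂μ with hθ
  have hA0 : 0 ≤ A := integral_nonneg fun _ => abs_nonneg _
  have hS0 : 0 ≤ S := integral_nonneg fun _ => sq_nonneg _
  have hC0 : 0 ≤ C := (abs_nonneg _).trans (hC (W 0 (nonempty_of_isProbabilityMeasure P).some))
  have hB0 : 0 ≤ B := (abs_nonneg _).trans
    (hB (W 0 (nonempty_of_isProbabilityMeasure P).some) (W 0 (nonempty_of_isProbabilityMeasure P).some))
  have hm : Measurable m := by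
    have : StronglyMeasurable (Function.uncurry fun w w' => k w' * G w w') :=
      ((hk.comp measurable_snd).mul hG).stronglyMeasurable
    exact this.integral_prod_right.measurable
  have hmB : ∀ w, |m w| ≤ B * A := fun w => abs_integral_mul_le hk hC (hB w)
  have hkm : ∀ w, |k w * m w| ≤ C * (B * A) := fun w => by
    rw [abs_mul]; exact mul_le_mul (hC _) (hmB _) (abs_nonneg _) hC0
  have hlaw_int : ∀ (i : ℕ) {φ : 𝒲 → ℝ}, Measurable φ → ∫ ω, φ (W i ω) ∂P = ∫ w, φ w ∂μ :=
    fun i φ hφ => by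
      rw [← h_law i, integral_map (hW i).aemeasurable hφ.aestronglyMeasurable]
  have hkW : ∀ i, Measurable fun ω => k (W i ω) := fun i => hk.comp (hW i)
  have hmW : ∀ i, Measurable fun ω => m (W i ω) := fun i => hm.comp (hW i)
  have hGW : ∀ i j, Measurable fun ω => G (W i ω) (W j ω) := fun i j =>
    hG.comp ((hW i).prodMk (hW j))
  have hbk : ∀ i ω, |k (W i ω)| ≤ C := fun i ω => hC _
  -- the four parts of the decomposition
  let D : ℕ → Ω → ℝ := fun i ω => k (W i ω) * ∑ j ∈ (Finset.range n).erase i,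
    (k (W j ω) * G (W i ω) (W j ω) - m (W i ω))
  let E : Ω → ℝ := fun ω => ∑ i ∈ Finset.range n, (k (W i ω) * m (W i ω) - θ)
  let T : ℕ → Ω → ℝ := fun i ω => k (W i ω) ^ 2 * G (W i ω) (W i ω)
  let R : ℕ → Ω → ℝ := fun i ω => k (W i ω) * m (W i ω)
  have hdecomp : ∀ ω, ∑ i ∈ Finset.range n, ∑ j ∈ Finset.range n,
      k (W i ω) * k (W j ω) * G (W i ω) (W j ω) - n ^ 2 * θ =
      ∑ i ∈ Finset.range n, D i ω + n * E ω + ∑ i ∈ Finset.range n, T i ω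
        - ∑ i ∈ Finset.range n, R i ω := fun ω => by
    have hrow : ∀ i ∈ Finset.range n, ∑ j ∈ Finset.range n,
        k (W i ω) * k (W j ω) * G (W i ω) (W j ω) =
        D i ω + n * (k (W i ω) * m (W i ω)) + T i ω - R i ω := fun i hi => by
      -- Off the diagonal a row has only `n - 1` centring terms, while `n * E` supplies `n` of them;
      -- `R i` is the surplus.
      have hn : (((Finset.range n).erase i).card : ℝ) = n - 1 := by
        rw [Finset.card_erase_of_mem hi, Finset.card_range, Nat.cast_pred]
        exact Nat.zero_lt_of_lt (Finset.mem_range.1 hi)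
      rw [← Finset.add_sum_erase _ _ hi]
      simp only [D, T, R, Finset.sum_sub_distrib, Finset.sum_const, nsmul_eq_mul, hn, mul_sub,
        Finset.mul_sum, ← mul_assoc]
      ring
    rw [Finset.sum_congr rfl hrow]
    simp only [E, Finset.sum_sub_distrib, Finset.sum_add_distrib, Finset.sum_const, nsmul_eq_mul,
      Finset.card_range, ← Finset.mul_sum]
    ring
  have hDint : ∀ i, Integrable (D i) P := fun i => by
    refine integrable_of_abs_le ((hkW i).mul (Finset.measurable_sum _ fun j _ =>
      ((hkW j).mul (hGW i j)).sub (hmW i)))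
      (C := C * ∑ _j ∈ (Finset.range n).erase i, (C * B + B * A)) fun ω => ?_
    rw [abs_mul]
    refine mul_le_mul (hbk _ _) ?_ (abs_nonneg _) hC0
    refine (Finset.abs_sum_le_sum_abs _ _).trans (Finset.sum_le_sum fun j _ => ?_)
    refine (abs_sub _ _).trans (add_le_add ?_ (hmB _))
    rw [abs_mul]
    exact mul_le_mul (hbk _ _) (hB _ _) (abs_nonneg _) hC0
  have hRint : ∀ i, Integrable (R i) P := fun i =>
    integrable_of_abs_le ((hkW i).mul (hmW i)) fun ω => hkm _
  have hEint : Integrable E P :=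
    integrable_finsetSum _ fun i _ => (hRint i).sub (integrable_const θ)
  have hk2 : Integrable (fun w => k w ^ 2) μ :=
    integrable_of_abs_le (hk.pow_const 2) (C := C ^ 2) fun w => by
      rw [abs_pow]; exact pow_le_pow_left₀ (abs_nonneg _) (hC w) 2
  have hTB : ∀ i ω, |T i ω| ≤ B * k (W i ω) ^ 2 := fun i ω => by
    simp only [T]
    rw [abs_mul, abs_of_nonneg (sq_nonneg _), mul_comm]
    exact mul_le_mul_of_nonneg_right (hB _ _) (sq_nonneg _)
  have hk2W : ∀ i, Integrable (fun ω => B * k (W i ω) ^ 2) P := fun i => by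
    refine Integrable.const_mul ?_ B
    exact integrable_of_abs_le ((hkW i).pow_const 2) (C := C ^ 2) fun w => by
      rw [abs_pow]; exact pow_le_pow_left₀ (abs_nonneg _) (hbk _ _) 2
  have hTint : ∀ i, Integrable (T i) P := fun i =>
    (hk2W i).mono' (((hkW i).pow_const 2).mul (hGW i i)).aestronglyMeasurable
      (ae_of_all _ fun ω => hTB i ω)
  have hpt : ∀ ω, |∑ i ∈ Finset.range n, ∑ j ∈ Finset.range n,
      k (W i ω) * k (W j ω) * G (W i ω) (W j ω) - n ^ 2 * θ| ≤
      ∑ i ∈ Finset.range n, |D i ω| + n * |E ω| + ∑ i ∈ Finset.range n, |T i ω|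
        + ∑ i ∈ Finset.range n, |R i ω| := fun ω => by
    rw [hdecomp ω]
    have h1 := Finset.abs_sum_le_sum_abs (fun i => D i ω) (Finset.range n)
    have h2 := Finset.abs_sum_le_sum_abs (fun i => T i ω) (Finset.range n)
    have h3 := Finset.abs_sum_le_sum_abs (fun i => R i ω) (Finset.range n)
    have h4 : |(n : ℝ) * E ω| = n * |E ω| := by rw [abs_mul, Nat.abs_cast]
    refine (abs_sub _ _).trans ((add_le_add (abs_add_three _ _ _) le_rfl).trans ?_)
    rw [h4]
    gcongr
  have hI1 : Integrable (fun ω => ∑ i ∈ Finset.range n, |D i ω|) P :=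
    integrable_finsetSum _ fun i _ => (hDint i).abs
  have hI2 : Integrable (fun ω => (n : ℝ) * |E ω|) P := hEint.abs.const_mul _
  have hI3 : Integrable (fun ω => ∑ i ∈ Finset.range n, |T i ω|) P :=
    integrable_finsetSum _ fun i _ => (hTint i).abs
  have hI4 : Integrable (fun ω => ∑ i ∈ Finset.range n, |R i ω|) P :=
    integrable_finsetSum _ fun i _ => (hRint i).abs
  refine (integral_mono_of_nonneg (ae_of_all _ fun ω => abs_nonneg _)
    (((hI1.add hI2).add hI3).add hI4) (ae_of_all _ hpt)).trans ?_
  have e1 : ∫ ω, ∑ i ∈ Finset.range n, |D i ω| ∂P ≤ n * (A * √(n * (B ^ 2 * S))) := by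
    rw [integral_finsetSum _ fun i _ => (hDint i).abs]
    refine (Finset.sum_le_card_nsmul _ _ (A * √(n * (B ^ 2 * S))) fun i _ => ?_).trans
      (by rw [Finset.card_range, nsmul_eq_mul])
    refine (integral_abs_mul_row_sub_le hW h_indep h_law hk hC hG hB i
      ((Finset.range n).erase i) (Finset.notMem_erase _ _)).trans ?_
    have : ((Finset.range n).erase i).card ≤ n := by
      simpa using Finset.card_erase_le (s := Finset.range n) (a := i)
    gcongr
  have e2 : ∫ ω, (n : ℝ) * |E ω| ∂P ≤ n * √(n * ((B * A) ^ 2 * S)) := by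
    rw [integral_const_mul]
    refine mul_le_mul_of_nonneg_left ?_ (Nat.cast_nonneg _)
    refine (integral_abs_sum_sub_le hW h_indep h_law (hk.mul hm) hkm (Finset.range n)).trans ?_
    rw [Finset.card_range]
    exact Real.sqrt_le_sqrt
      (mul_le_mul_of_nonneg_left (integral_sq_mul_le hk hC hmB) (Nat.cast_nonneg _))
  have e3 : ∫ ω, ∑ i ∈ Finset.range n, |T i ω| ∂P ≤ n * (B * S) := by
    rw [integral_finsetSum _ fun i _ => (hTint i).abs]
    refine (Finset.sum_le_card_nsmul _ _ (B * S) fun i _ => ?_).trans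
      (by rw [Finset.card_range, nsmul_eq_mul])
    refine (integral_mono (hTint i).abs (hk2W i) (hTB i)).trans ?_
    rw [integral_const_mul, hlaw_int i (hk.pow_const 2)]
  have e4 : ∫ ω, ∑ i ∈ Finset.range n, |R i ω| ∂P ≤ n * ((B * A) * A) := by
    rw [integral_finsetSum _ fun i _ => (hRint i).abs]
    refine (Finset.sum_le_card_nsmul _ _ ((B * A) * A) fun i _ => ?_).trans
      (by rw [Finset.card_range, nsmul_eq_mul])
    rw [hlaw_int i (φ := fun w => |k w * m w|) (hk.mul hm).abs, hA, ← integral_const_mul]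
    refine integral_mono_of_nonneg (ae_of_all _ fun w => abs_nonneg _)
      ((integrable_of_abs_le hk hC).abs.const_mul _) (ae_of_all _ fun w => ?_)
    simp only [abs_mul]
    rw [mul_comm]
    exact mul_le_mul_of_nonneg_right (hmB w) (abs_nonneg _)
  calc ∫ ω, (((fun ω => ∑ i ∈ Finset.range n, |D i ω|) + fun ω => (n : ℝ) * |E ω|)
        + (fun ω => ∑ i ∈ Finset.range n, |T i ω|)
        + fun ω => ∑ i ∈ Finset.range n, |R i ω|) ω ∂P
      = ∫ ω, ∑ i ∈ Finset.range n, |D i ω| ∂P + ∫ ω, (n : ℝ) * |E ω| ∂P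
        + ∫ ω, ∑ i ∈ Finset.range n, |T i ω| ∂P + ∫ ω, ∑ i ∈ Finset.range n, |R i ω| ∂P := by
        rw [integral_add' ((hI1.add hI2).add hI3) hI4, integral_add' (hI1.add hI2) hI3,
          integral_add' hI1 hI2]
    _ ≤ _ := by gcongr

end UStatistic

/-! ### Approximate identities from rescaled kernels -/

section Kernels

variable {p : ℕ}

/-- This is the peak-function theorem at scale `(h n)⁻¹`, after moving `z` to the origin and
dividing `K` by its mass. The tail condition replaces compact support, so continuity of `q` is
needed only at `z`. -/
theorem tendsto_integral_scaledKernel_mul_of_nonneg {K : Cov p → ℝ} (hK0 : ∀ u, 0 ≤ K u)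
    (hKpos : 0 < ∫ u, K u)
    (hK_tail : Tendsto (fun t : Cov p => K t * ‖t‖ ^ p) (cocompact (Cov p)) (𝓝 0))
    {h : ℕ → ℝ} (h_pos : ∀ n, 0 < h n) (h_zero : Tendsto h atTop (𝓝 0))
    {q : Cov p → ℝ} (hq : Integrable q) {z : Cov p} (hqz : ContinuousAt q z) :
    Tendsto (fun n => ∫ u, scaledKernel K (h n) (u - z) * q u) atTop
      (𝓝 ((∫ u, K u) * q z)) := by
  set m := ∫ u, K u with hm
  have hinv : Tendsto (fun n => (h n)⁻¹) atTop atTop :=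
    tendsto_inv_nhdsGT_zero.comp
      (tendsto_nhdsWithin_iff.2 ⟨h_zero, Eventually.of_forall h_pos⟩)
  have hq' : Integrable fun x => q (x + z) := hq.comp_add_right z
  have hqz' : ContinuousAt (fun x => q (x + z)) 0 := by
    refine ContinuousAt.comp (f := fun x => x + z) (x := 0) (by simpa using hqz) ?_
    fun_prop
  have htail' : Tendsto (fun x : Cov p => ‖x‖ ^ Module.finrank ℝ (Cov p) * (m⁻¹ * K x))
      (Bornology.cobounded (Cov p)) (𝓝 0) := by
    rw [Metric.cobounded_eq_cocompact, finrank_euclideanSpace_fin]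
    have := hK_tail.const_mul m⁻¹
    rw [mul_zero] at this
    exact this.congr fun x => by ring
  have key := (tendsto_integral_comp_smul_smul_of_integrable (μ := volume)
    (φ := fun x => m⁻¹ * K x) (fun x => mul_nonneg (inv_nonneg.2 hKpos.le) (hK0 x))
    (by rw [integral_const_mul, ← hm, inv_mul_cancel₀ hKpos.ne']) htail' hq' hqz').comp hinv
  have key2 := key.const_mul m
  simp only [zero_add] at key2
  refine key2.congr fun n => ?_
  rw [Function.comp_apply, ← integral_const_mul,
    ← integral_add_right_eq_self (fun u => scaledKernel K (h n) (u - z) * q u) z]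
  congr 1 with x
  simp only [scaledKernel, add_sub_cancel_right, finrank_euclideanSpace_fin, smul_eq_mul, inv_pow]
  field_simp

theorem tendsto_abs_mul_norm_pow {K : Cov p → ℝ}
    (hK_tail : Tendsto (fun t : Cov p => K t * ‖t‖ ^ p) (cocompact (Cov p)) (𝓝 0)) :
    Tendsto (fun t : Cov p => |K t| * ‖t‖ ^ p) (cocompact (Cov p)) (𝓝 0) := by
  have := hK_tail.abs
  rw [abs_zero] at this
  exact this.congr fun t => by rw [abs_mul, abs_of_nonneg (pow_nonneg (norm_nonneg t) p)]

theorem abs_scaledKernel (K : Cov p → ℝ) {h : ℝ} (hh : 0 < h) (u : Cov p) :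
    |scaledKernel K h u| = scaledKernel (fun u => |K u|) h u := by
  rw [scaledKernel, scaledKernel, abs_mul, abs_of_pos (inv_pos.2 (pow_pos hh p))]

theorem tendsto_integral_abs_scaledKernel_mul {K : Cov p → ℝ} (hKpos : 0 < ∫ u, |K u|)
    (hK_tail : Tendsto (fun t : Cov p => K t * ‖t‖ ^ p) (cocompact (Cov p)) (𝓝 0))
    {h : ℕ → ℝ} (h_pos : ∀ n, 0 < h n) (h_zero : Tendsto h atTop (𝓝 0))
    {q : Cov p → ℝ} (hq : Integrable q) {z : Cov p} (hqz : ContinuousAt q z) :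
    Tendsto (fun n => ∫ u, |scaledKernel K (h n) (u - z)| * q u) atTop
      (𝓝 ((∫ u, |K u|) * q z)) := by
  simp only [fun n u => abs_scaledKernel K (h_pos n) u]
  exact tendsto_integral_scaledKernel_mul_of_nonneg (fun u => abs_nonneg (K u)) hKpos
    (tendsto_abs_mul_norm_pow hK_tail) h_pos h_zero hq hqz

theorem measurable_scaledKernel {K : Cov p → ℝ} (hK : Measurable K) (h : ℝ) :
    Measurable (scaledKernel K h) :=
  (hK.comp (measurable_const_smul _)).const_mul _

theorem abs_scaledKernel_le {K : Cov p → ℝ} {C : ℝ} (hC : ∀ u, |K u| ≤ C) {h : ℝ} (hh : 0 < h)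
    (u : Cov p) : |scaledKernel K h u| ≤ (h ^ p)⁻¹ * C := by
  rw [abs_scaledKernel K hh]
  exact mul_le_mul_of_nonneg_left (hC _) (inv_nonneg.2 (pow_pos hh p).le)

/-- Bochner's approximation of the identity for signed kernels. -/
theorem tendsto_integral_scaledKernel_mul {K : Cov p → ℝ} (hK_meas : Measurable K) {C : ℝ}
    (hC : ∀ u, |K u| ≤ C) (hKint : Integrable K) (hKpos : 0 < ∫ u, |K u|)
    (hK_tail : Tendsto (fun t : Cov p => K t * ‖t‖ ^ p) (cocompact (Cov p)) (𝓝 0))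
    {h : ℕ → ℝ} (h_pos : ∀ n, 0 < h n) (h_zero : Tendsto h atTop (𝓝 0))
    {q : Cov p → ℝ} (hq : Integrable q) {z : Cov p} (hqz : ContinuousAt q z) :
    Tendsto (fun n => ∫ u, scaledKernel K (h n) (u - z) * q u) atTop
      (𝓝 ((∫ u, K u) * q z)) := by
  have habs := tendsto_integral_abs_scaledKernel_mul hKpos hK_tail h_pos h_zero hq hqz
  -- The kernel is split as `(K + 2|K|) - 2|K|`. With factor `1` the first piece would be
  -- nonnegative but could have mass zero; with factor `2` its mass is at least that of `|K|`.
  have hint : ∫ u, (K u + 2 * |K u|) = (∫ u, K u) + 2 * ∫ u, |K u| := by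
    rw [integral_add hKint (hKint.abs.const_mul 2), integral_const_mul]
  have hpos : 0 < ∫ u, (K u + 2 * |K u|) := by
    have := abs_le.1 (abs_integral_le_integral_abs (f := K) (μ := volume))
    rw [hint]
    linarith
  have htail : Tendsto (fun t : Cov p => (K t + 2 * |K t|) * ‖t‖ ^ p)
      (cocompact (Cov p)) (𝓝 0) := by
    have := hK_tail.add ((tendsto_abs_mul_norm_pow hK_tail).const_mul 2)
    simp only [mul_zero, add_zero] at this
    exact this.congr fun t => by ring
  have hsum := tendsto_integral_scaledKernel_mul_of_nonneg (K := fun u => K u + 2 * |K u|)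
    (fun u => by have := neg_abs_le (K u); have := abs_nonneg (K u); linarith) hpos htail
    h_pos h_zero hq hqz
  have := hsum.sub (habs.const_mul 2)
  rw [hint] at this
  have e : ((∫ u, K u) + 2 * ∫ u, |K u|) * q z - 2 * ((∫ u, |K u|) * q z) =
      (∫ u, K u) * q z := by ring
  rw [e] at this
  refine this.congr fun n => ?_
  have hm : Measurable fun u => scaledKernel K (h n) (u - z) :=
    (measurable_scaledKernel hK_meas _).comp (measurable_id.sub_const z)
  have hI : Integrable fun u => scaledKernel K (h n) (u - z) * q u :=
    hq.bdd_mul hm.aestronglyMeasurable (ae_of_all _ fun u => abs_scaledKernel_le hC (h_pos n) _)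
  have hIabs : Integrable fun u => |scaledKernel K (h n) (u - z)| * q u :=
    hq.bdd_mul hm.abs.aestronglyMeasurable (ae_of_all _ fun u => by
      rw [Real.norm_eq_abs, abs_abs]; exact abs_scaledKernel_le hC (h_pos n) _)
  rw [← integral_const_mul, sub_eq_iff_eq_add, ← integral_add hI (hIabs.const_mul 2)]
  congr 1 with u
  rw [abs_scaledKernel K (h_pos n)]
  simp only [scaledKernel]
  ring

/-- An integrable function agrees off a null set with a Borel function of smaller modulus. -/
theorem exists_measurable_ae_eq_abs_le {K : Cov p → ℝ} (hK : Integrable K) :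
    ∃ K' : Cov p → ℝ, Measurable K' ∧ K' =ᵐ[volume] K ∧ ∀ u, |K' u| ≤ |K u| := by
  have hmk := hK.aestronglyMeasurable.ae_eq_mk
  obtain ⟨s, hs, hs_meas, hs_null⟩ := exists_measurable_superset_of_null (ae_iff.1 hmk)
  have hoff : ∀ u ∉ s, K u = hK.aestronglyMeasurable.mk K u := fun u hu => by
    by_contra hne
    exact hu (hs hne)
  -- Zero on a Borel null set containing all disagreements makes the modulus bound hold everywhere,
  -- so boundedness and tail decay pass to the Borel version.
  refine ⟨sᶜ.indicator (hK.aestronglyMeasurable.mk K),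
    hK.aestronglyMeasurable.stronglyMeasurable_mk.measurable.indicator hs_meas.compl, ?_, ?_⟩
  · filter_upwards [measure_eq_zero_iff_ae_notMem.1 hs_null] with u hu
    rw [indicator_of_mem (mem_compl hu), hoff u hu]
  · intro u
    by_cases hu : u ∈ s
    · rw [indicator_of_notMem (by simpa using hu), abs_zero]
      exact abs_nonneg _
    · rw [indicator_of_mem (mem_compl hu), hoff u hu]

end Kernels

/-! ### The law of the covariate -/

section Design

variable {p : ℕ} {fZ : Cov p → ℝ} {κ : Kernel (Cov p) (ℝ × ℝ)} [IsMarkovKernel κ]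

/-- The law of the covariate with density `fZ`. -/
noncomputable abbrev covLaw (fZ : Cov p → ℝ) : Measure (Cov p) :=
  volume.withDensity fun z => ENNReal.ofReal (fZ z)

theorem integral_covLaw (hfZ_meas : Measurable fZ) (hfZ_nonneg : ∀ z, 0 ≤ fZ z)
    (φ : Cov p → ℝ) : ∫ u, φ u ∂(covLaw fZ) = ∫ u, φ u * fZ u := by
  rw [integral_withDensity_eq_integral_toReal_smul hfZ_meas.ennreal_ofReal
    (ae_of_all _ fun _ => ENNReal.ofReal_lt_top)]
  congr 1 with u
  rw [ENNReal.toReal_ofReal (hfZ_nonneg u), smul_eq_mul, mul_comm]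

theorem integrable_density [IsFiniteMeasure (covLaw fZ)] (hfZ_meas : Measurable fZ)
    (hfZ_nonneg : ∀ z, 0 ≤ fZ z) : Integrable fZ := by
  refine ⟨hfZ_meas.aestronglyMeasurable, ?_⟩
  rw [hasFiniteIntegral_iff_ofReal (ae_of_all _ hfZ_nonneg)]
  have := measure_lt_top (covLaw fZ) univ
  rwa [withDensity_apply _ MeasurableSet.univ, Measure.restrict_univ] at this

theorem integral_fst_compProd [IsFiniteMeasure (covLaw fZ)] {φ : Cov p → ℝ}
    (hφ : Measurable φ) :
    ∫ w, φ w.1 ∂(Measure.compProd (covLaw fZ) κ) = ∫ u, φ u ∂(covLaw fZ) := by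
  conv_rhs => rw [← Measure.fst_compProd (covLaw fZ) κ]
  rw [Measure.fst, integral_map measurable_fst.aemeasurable hφ.aestronglyMeasurable]

end Design

/-! ### Concordance functions and their conditional means -/

section Concordance

/-- The symmetrisation of a function of two observations. -/
noncomputable def symmetrization (g : ℝ × ℝ → ℝ × ℝ → ℝ) (x y : ℝ × ℝ) : ℝ :=
  (g x y + g y x) / 2

theorem measurable_gOne : Measurable (Function.uncurry gOne) := by
  unfold gOne Function.uncurry
  refine ((Measurable.ite ?_ measurable_const measurable_const).const_mul _).sub_const _
  exact (measurableSet_lt (α := ℝ) (f := fun q : (ℝ × ℝ) × (ℝ × ℝ) => q.1.1)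
    (g := fun q => q.2.1) (by fun_prop) (by fun_prop)).inter (measurableSet_lt (α := ℝ)
      (f := fun q : (ℝ × ℝ) × (ℝ × ℝ) => q.1.2) (g := fun q => q.2.2) (by fun_prop) (by fun_prop))

theorem measurable_gTwo : Measurable (Function.uncurry gTwo) := by
  unfold gTwo Function.uncurry
  exact (Measurable.ite (measurableSet_lt (by fun_prop) (by fun_prop)) measurable_const
    measurable_const).sub (Measurable.ite (measurableSet_lt (by fun_prop) (by fun_prop))
      measurable_const measurable_const)

theorem measurable_gThree : Measurable (Function.uncurry gThree) := by
  unfold gThree Function.uncurry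
  refine ((Measurable.ite ?_ measurable_const measurable_const).const_mul _).const_sub _
  exact (measurableSet_lt (α := ℝ) (f := fun q : (ℝ × ℝ) × (ℝ × ℝ) => q.1.1)
    (g := fun q => q.2.1) (by fun_prop) (by fun_prop)).inter (measurableSet_lt (α := ℝ)
      (f := fun q : (ℝ × ℝ) × (ℝ × ℝ) => q.2.2) (g := fun q => q.1.2) (by fun_prop) (by fun_prop))

theorem abs_gOne_le (x y : ℝ × ℝ) : |gOne x y| ≤ 3 := by
  unfold gOne; split_ifs <;> norm_num

theorem abs_gTwo_le (x y : ℝ × ℝ) : |gTwo x y| ≤ 3 := by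
  unfold gTwo; split_ifs <;> norm_num

theorem abs_gThree_le (x y : ℝ × ℝ) : |gThree x y| ≤ 3 := by
  unfold gThree; split_ifs <;> norm_num

variable {g : ℝ × ℝ → ℝ × ℝ → ℝ}

theorem measurable_symmetrization (hg : g = gOne ∨ g = gTwo ∨ g = gThree) :
    Measurable (Function.uncurry (symmetrization g)) := by
  have hm : Measurable (Function.uncurry g) := by
    rcases hg with rfl | rfl | rfl
    exacts [measurable_gOne, measurable_gTwo, measurable_gThree]
  exact (hm.add (hm.comp measurable_swap)).div_const 2

theorem abs_symmetrization_le (hg : g = gOne ∨ g = gTwo ∨ g = gThree) (x y : ℝ × ℝ) :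
    |symmetrization g x y| ≤ 3 := by
  have hb : ∀ x y, |g x y| ≤ 3 := by
    rcases hg with rfl | rfl | rfl
    exacts [abs_gOne_le, abs_gTwo_le, abs_gThree_le]
  have h1 := abs_le.1 (hb x y)
  have h2 := abs_le.1 (hb y x)
  unfold symmetrization
  rw [abs_le]
  constructor <;> linarith

/-- Without ties the three symmetrised functions coincide. -/
theorem symmetrization_eq_gTwo (hg : g = gOne ∨ g = gTwo ∨ g = gThree) {x y : ℝ × ℝ}
    (h1 : x.1 ≠ y.1) (h2 : x.2 ≠ y.2) : symmetrization g x y = gTwo x y := by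
  rcases lt_or_gt_of_ne h1 with a | a <;> rcases lt_or_gt_of_ne h2 with b | b
  · have hc : 0 < (x.1 - y.1) * (x.2 - y.2) := mul_pos_of_neg_of_neg (by linarith) (by linarith)
    have hc' : 0 < (y.1 - x.1) * (y.2 - x.2) := mul_pos (by linarith) (by linarith)
    rcases hg with rfl | rfl | rfl <;>
      (simp [symmetrization, gOne, gTwo, gThree, a, b, a.not_gt, b.not_gt, hc, hc',
        hc.not_gt, hc'.not_gt]; try norm_num)
  · have hc : (x.1 - y.1) * (x.2 - y.2) < 0 := mul_neg_of_neg_of_pos (by linarith) (by linarith)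
    have hc' : (y.1 - x.1) * (y.2 - x.2) < 0 := mul_neg_of_pos_of_neg (by linarith) (by linarith)
    rcases hg with rfl | rfl | rfl <;>
      (simp [symmetrization, gOne, gTwo, gThree, a, b, a.not_gt, b.not_gt, hc, hc',
        hc.not_gt, hc'.not_gt]; try norm_num)
  · have hc : (x.1 - y.1) * (x.2 - y.2) < 0 := mul_neg_of_pos_of_neg (by linarith) (by linarith)
    have hc' : (y.1 - x.1) * (y.2 - x.2) < 0 := mul_neg_of_neg_of_pos (by linarith) (by linarith)
    rcases hg with rfl | rfl | rfl <;>
      (simp [symmetrization, gOne, gTwo, gThree, a, b, a.not_gt, b.not_gt, hc, hc',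
        hc.not_gt, hc'.not_gt]; try norm_num)
  · have hc : 0 < (x.1 - y.1) * (x.2 - y.2) := mul_pos (by linarith) (by linarith)
    have hc' : 0 < (y.1 - x.1) * (y.2 - x.2) := mul_pos_of_neg_of_neg (by linarith) (by linarith)
    rcases hg with rfl | rfl | rfl <;>
      (simp [symmetrization, gOne, gTwo, gThree, a, b, a.not_gt, b.not_gt, hc, hc',
        hc.not_gt, hc'.not_gt]; try norm_num)

variable {p : ℕ} {κ : Kernel (Cov p) (ℝ × ℝ)} [IsMarkovKernel κ]

theorem measurableSet_concordantSet : MeasurableSet concordantSet :=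
  measurableSet_lt (by fun_prop) (by fun_prop)

theorem measurableSet_discordantSet : MeasurableSet discordantSet :=
  measurableSet_lt (by fun_prop) (by fun_prop)

theorem abs_condTauPair_le (u v : Cov p) : |condTauPair κ u v| ≤ 1 := by
  have h1 : ((κ u).prod (κ v)).real concordantSet ≤ 1 := measureReal_le_one
  have h2 : ((κ u).prod (κ v)).real discordantSet ≤ 1 := measureReal_le_one
  have h3 : 0 ≤ ((κ u).prod (κ v)).real concordantSet := measureReal_nonneg
  have h4 : 0 ≤ ((κ u).prod (κ v)).real discordantSet := measureReal_nonneg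
  unfold condTauPair
  rw [abs_le]
  constructor <;> linarith

/-- Atomless margins make ties null under `κ u ⊗ κ v`: for fixed `x`, the `y` sharing a coordinate
with `x` form a `κ v`-null set. Off ties the integrand is the concordance indicator minus the
discordance indicator. -/
theorem integral_symmetrization (hg : g = gOne ∨ g = gTwo ∨ g = gThree)
    (h_margins : ∀ z t, κ z {x | x.1 = t} = 0 ∧ κ z {x | x.2 = t} = 0) (u v : Cov p) :
    ∫ x, ∫ y, symmetrization g x y ∂(κ v) ∂(κ u) = condTauPair κ u v := by
  have hint : Integrable (Function.uncurry (symmetrization g)) ((κ u).prod (κ v)) :=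
    integrable_of_abs_le (measurable_symmetrization hg) fun q => abs_symmetrization_le hg q.1 q.2
  have hprod := integral_prod _ hint
  simp only [Function.uncurry] at hprod
  rw [← hprod]
  have hnull1 : ∀ᵐ q ∂((κ u).prod (κ v)), q.1.1 ≠ q.2.1 := by
    rw [ae_iff]
    simp only [not_not]
    rw [Measure.measure_prod_null (measurableSet_eq_fun (by fun_prop) (by fun_prop))]
    refine ae_of_all _ fun x => ?_
    have := (h_margins v x.1).1
    simpa [Set.preimage, eq_comm] using this
  have hnull2 : ∀ᵐ q ∂((κ u).prod (κ v)), q.1.2 ≠ q.2.2 := by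
    rw [ae_iff]
    simp only [not_not]
    rw [Measure.measure_prod_null (measurableSet_eq_fun (by fun_prop) (by fun_prop))]
    refine ae_of_all _ fun x => ?_
    have := (h_margins v x.2).2
    simpa [Set.preimage, eq_comm] using this
  have hae : (fun q : (ℝ × ℝ) × (ℝ × ℝ) => symmetrization g q.1 q.2)
      =ᵐ[(κ u).prod (κ v)] fun q => concordantSet.indicator (fun _ => (1 : ℝ)) q
        - discordantSet.indicator (fun _ => (1 : ℝ)) q := by
    filter_upwards [hnull1, hnull2] with q h1 h2
    rw [symmetrization_eq_gTwo hg h1 h2]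
    simp only [gTwo, indicator, concordantSet, discordantSet, mem_ofPred_eq]
    congr
  rw [integral_congr_ae hae, integral_sub
    ((integrable_const _).indicator measurableSet_concordantSet)
    ((integrable_const _).indicator measurableSet_discordantSet),
    integral_indicator_const _ measurableSet_concordantSet,
    integral_indicator_const _ measurableSet_discordantSet]
  simp [condTauPair]

/-- Disintegration of a weighted double integral over two independent copies of `(Z, X)`. -/
theorem integral_compProd_weighted {ν : Measure (Cov p)} [IsProbabilityMeasure ν]
    {k : Cov p → ℝ} (hk : Measurable k) {C : ℝ} (hC : ∀ u, |k u| ≤ C)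
    {G : ℝ × ℝ → ℝ × ℝ → ℝ} (hG : Measurable (Function.uncurry G)) {B : ℝ}
    (hB : ∀ x y, |G x y| ≤ B) :
    ∫ w, k w.1 * ∫ w', k w'.1 * G w.2 w'.2 ∂(Measure.compProd ν κ) ∂(Measure.compProd ν κ) =
      ∫ u, k u * ∫ v, k v * ∫ x, ∫ y, G x y ∂(κ v) ∂(κ u) ∂ν ∂ν := by
  have hC0 : ∀ u : Cov p, 0 ≤ C := fun u => (abs_nonneg _).trans (hC u)
  have hkG : ∀ (u : Cov p) x y, |k u * G x y| ≤ C * B := fun u x y => by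
    rw [abs_mul]; exact mul_le_mul (hC _) (hB _ _) (abs_nonneg _) (hC0 u)
  have hinner : ∀ x : ℝ × ℝ, ∫ w', k w'.1 * G x w'.2 ∂(Measure.compProd ν κ) =
      ∫ v, k v * ∫ y, G x y ∂(κ v) ∂ν := fun x => by
    rw [Measure.integral_compProd]
    · simp only [integral_const_mul]
    · exact integrable_of_abs_le ((hk.comp measurable_fst).mul
        (hG.comp (measurable_const.prodMk measurable_snd))) fun w => hkG _ _ _
  simp only [hinner]
  have hΓ : StronglyMeasurable fun q : (ℝ × ℝ) × Cov p => ∫ y, G q.1 y ∂(κ q.2) := by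
    have : StronglyMeasurable fun r : ((ℝ × ℝ) × Cov p) × (ℝ × ℝ) => G r.1.1 r.2 :=
      (hG.comp ((measurable_fst.comp measurable_fst).prodMk measurable_snd)).stronglyMeasurable
    exact this.integral_kernel_prod_right' (κ := Kernel.prodMkLeft (ℝ × ℝ) κ)
  have hΓB : ∀ x v, |∫ y, G x y ∂(κ v)| ≤ B := fun x v => by
    simpa using norm_integral_le_of_norm_le_const (μ := κ v)
      (ae_of_all _ (hB x) : ∀ᵐ y ∂(κ v), ‖G x y‖ ≤ B)
  have hkΓ : Measurable fun q : (ℝ × ℝ) × Cov p => k q.2 * ∫ y, G q.1 y ∂(κ q.2) :=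
    (hk.comp measurable_snd).mul hΓ.measurable
  have hkΓB : ∀ x v, |k v * ∫ y, G x y ∂(κ v)| ≤ C * B := fun x v => by
    rw [abs_mul]; exact mul_le_mul (hC _) (hΓB _ _) (abs_nonneg _) (hC0 v)
  have hM : Measurable fun x : ℝ × ℝ => ∫ v, k v * ∫ y, G x y ∂(κ v) ∂ν :=
    (StronglyMeasurable.integral_prod_right' (ν := ν) hkΓ.stronglyMeasurable).measurable
  have hMB : ∀ x, |∫ v, k v * ∫ y, G x y ∂(κ v) ∂ν| ≤ C * B := fun x => by
    simpa using norm_integral_le_of_norm_le_const (μ := ν)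
      (ae_of_all _ (hkΓB x) : ∀ᵐ v ∂ν, ‖k v * ∫ y, G x y ∂(κ v)‖ ≤ C * B)
  rw [Measure.integral_compProd]
  · congr 1 with u
    dsimp only
    -- The first observation `x` is integrated inside the second covariate `v`; Fubini applies as
    -- the integrand is bounded and both laws are finite.
    rw [integral_const_mul, integral_integral_swap]
    · simp only [integral_const_mul]
    · exact integrable_of_abs_le hkΓ fun q => hkΓB q.1 q.2
  · refine integrable_of_abs_le ((hk.comp measurable_fst).mul (hM.comp measurable_snd))
      (C := C * (C * B)) fun w => ?_
    rw [abs_mul]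
    exact mul_le_mul (hC _) (hMB _) (abs_nonneg _) (hC0 w.1)

/-- A weighted double integral of a bounded function that is small near the diagonal point. -/
theorem abs_integral_integral_weighted_le {ν : Measure (Cov p)} [IsProbabilityMeasure ν]
    {k : Cov p → ℝ} (hk : Measurable k) {C : ℝ} (hC : ∀ u, |k u| ≤ C)
    {T : Cov p → Cov p → ℝ} (hT : ∀ u v, |T u v| ≤ 2) {s : Set (Cov p)} (hs : MeasurableSet s)
    {ε : ℝ} (hε : 0 ≤ ε) (hTs : ∀ u ∈ s, ∀ v ∈ s, |T u v| ≤ ε) :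
    |∫ u, k u * ∫ v, k v * T u v ∂ν ∂ν| ≤ ε * (∫ u, |k u| ∂ν) ^ 2 +
      4 * (∫ u, |k u| ∂ν) * ∫ u, |k u| * sᶜ.indicator 1 u ∂ν := by
  set A := ∫ u, |k u| ∂ν with hA
  set A' := ∫ u, |k u| * sᶜ.indicator 1 u ∂ν with hA'
  have hkI : Integrable (fun u => |k u|) ν := (integrable_of_abs_le hk hC).abs
  have hkI' : Integrable (fun u => |k u| * sᶜ.indicator 1 u) ν := by
    refine (hkI.indicator hs.compl).congr (ae_of_all _ fun u => ?_)
    by_cases hu : u ∈ sᶜ <;> simp [hu]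
  -- Outside `s ×ˢ s` at least one indicator equals `1` and contributes the trivial bound `2`. The
  -- two indicator terms integrate to `2 * A * A'` each, whence the constant `4`.
  have hpt : ∀ u v, |T u v| ≤ ε + 2 * sᶜ.indicator 1 v + 2 * sᶜ.indicator 1 u := fun u v => by
    have h2 := hT u v
    by_cases hu : u ∈ s <;> by_cases hv : v ∈ s
    · simpa [hu, hv] using hTs u hu v hv
    all_goals simp [hu, hv]; linarith
  have hin : ∀ u, |∫ v, k v * T u v ∂ν| ≤ ε * A + 2 * A' + 2 * sᶜ.indicator 1 u * A := fun u => by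
    have hI : Integrable (fun v => ε * |k v| + 2 * (|k v| * sᶜ.indicator 1 v)
        + 2 * sᶜ.indicator 1 u * |k v|) ν :=
      ((hkI.const_mul _).add (hkI'.const_mul _)).add (hkI.const_mul _)
    have := norm_integral_le_of_norm_le (f := fun v => k v * T u v) hI (ae_of_all _ fun v => by
      rw [Real.norm_eq_abs, abs_mul]
      have := mul_le_mul_of_nonneg_left (hpt u v) (abs_nonneg (k v))
      linarith)
    have hI₂ : Integrable (fun v => ε * |k v| + 2 * (|k v| * sᶜ.indicator 1 v)) ν :=
      (hkI.const_mul _).add (hkI'.const_mul _)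
    rw [Real.norm_eq_abs, integral_add hI₂ (hkI.const_mul _),
      integral_add (hkI.const_mul _) (hkI'.const_mul _)] at this
    simpa only [integral_const_mul] using this
  have hI : Integrable (fun u => (ε * A + 2 * A') * |k u|
      + 2 * A * (|k u| * sᶜ.indicator 1 u)) ν :=
    (hkI.const_mul _).add (hkI'.const_mul _)
  have := norm_integral_le_of_norm_le (f := fun u => k u * ∫ v, k v * T u v ∂ν) hI
    (ae_of_all _ fun u => by
      rw [Real.norm_eq_abs, abs_mul]
      have := mul_le_mul_of_nonneg_left (hin u) (abs_nonneg (k u))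
      linarith)
  rw [Real.norm_eq_abs, integral_add (hkI.const_mul _) (hkI'.const_mul _)] at this
  simp only [integral_const_mul] at this
  rw [← hA, ← hA'] at this
  linarith

end Concordance

/-! ### Convergence in probability to a constant -/

section InMeasure

variable {Ω : Type*} [MeasurableSpace Ω] {P : Measure Ω}

/-- With a constant limit, convergence in probability depends only on neighbourhoods of that
constant. Continuous mapping at a single point and joint convergence then become neighbourhood and
union-bound arguments. -/
theorem tendstoInMeasure_const_iff {E : Type*} [PseudoMetricSpace E] {Y : ℕ → Ω → E} {c : E} :
    TendstoInMeasure P Y atTop (fun _ => c) ↔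
      ∀ U ∈ 𝓝 c, Tendsto (fun n => P {ω | Y n ω ∉ U}) atTop (𝓝 0) := by
  rw [tendstoInMeasure_iff_dist]
  constructor
  · intro h U hU
    obtain ⟨ε, hε, hU⟩ := Metric.mem_nhds_iff.1 hU
    refine tendsto_of_tendsto_of_tendsto_of_le_of_le tendsto_const_nhds (h ε hε)
      (fun _ => zero_le) fun n => measure_mono fun ω hω => ?_
    by_contra hlt
    exact hω (hU (by simpa using hlt))
  · intro h ε hε
    refine tendsto_of_tendsto_of_tendsto_of_le_of_le tendsto_const_nhds
      (h _ (Metric.ball_mem_nhds c hε)) (fun _ => zero_le) fun n => measure_mono fun ω hω => ?_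
    simpa using hω

theorem MeasureTheory.TendstoInMeasure.comp_continuousAt_const {E F : Type*} [PseudoMetricSpace E]
    [PseudoMetricSpace F] {Y : ℕ → Ω → E} {c : E} (h : TendstoInMeasure P Y atTop fun _ => c)
    {f : E → F} (hf : ContinuousAt f c) :
    TendstoInMeasure P (fun n ω => f (Y n ω)) atTop fun _ => f c := by
  rw [tendstoInMeasure_const_iff] at h ⊢
  exact fun U hU => h _ (hf hU)

theorem MeasureTheory.TendstoInMeasure.pi_const {ι : Type*} [Fintype ι] {E : Type*} [PseudoMetricSpace E]
    {Y : ι → ℕ → Ω → E} {c : ι → E} (h : ∀ i, TendstoInMeasure P (Y i) atTop fun _ => c i) :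
    TendstoInMeasure P (fun n ω i => Y i n ω) atTop fun _ => c := by
  simp only [tendstoInMeasure_const_iff] at h
  rw [tendstoInMeasure_const_iff]
  intro U hU
  rw [nhds_pi, Filter.mem_pi] at hU
  obtain ⟨I, -, t, ht, htU⟩ := hU
  have hsum : Tendsto (fun n => ∑ i, P {ω | Y i n ω ∉ t i}) atTop (𝓝 0) := by
    simpa using tendsto_finsetSum Finset.univ fun i _ => h i (t i) (ht i)
  refine tendsto_of_tendsto_of_tendsto_of_le_of_le tendsto_const_nhds hsum
    (fun _ => zero_le) fun n => (measure_mono fun ω hω => ?_).trans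
      (measure_biUnion_finset_le Finset.univ fun i => {ω | Y i n ω ∉ t i})
  by_contra hcon
  simp only [mem_iUnion, not_exists, Finset.mem_univ, mem_ofPred_eq, not_not, exists_prop,
    true_and] at hcon
  exact hω (htU fun i _ => hcon i)

theorem MeasureTheory.TendstoInMeasure.prodMk_const {E F : Type*} [PseudoMetricSpace E] [PseudoMetricSpace F]
    {Y : ℕ → Ω → E} {c : E} (hY : TendstoInMeasure P Y atTop fun _ => c)
    {Y' : ℕ → Ω → F} {c' : F} (hY' : TendstoInMeasure P Y' atTop fun _ => c') :
    TendstoInMeasure P (fun n ω => (Y n ω, Y' n ω)) atTop fun _ => (c, c') := by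
  rw [tendstoInMeasure_const_iff] at hY hY' ⊢
  intro U hU
  obtain ⟨s, hs, t, ht, hst⟩ := mem_nhds_prod_iff.1 hU
  have hsum := (hY s hs).add (hY' t ht)
  rw [add_zero] at hsum
  refine tendsto_of_tendsto_of_tendsto_of_le_of_le tendsto_const_nhds hsum
    (fun _ => zero_le) fun n => (measure_mono fun ω hω => ?_).trans (measure_union_le _ _)
  by_contra hcon
  simp only [mem_union, mem_ofPred_eq, not_or, not_not] at hcon
  exact hω (hst hcon)

/-- The centring `θ n` may move with `n`: the stochastic error and the deterministic bias `|θ n -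
c|` add up to an `L¹` bound. -/
theorem tendstoInMeasure_const_of_integral_abs_sub {Y : ℕ → Ω → ℝ}
    (hY : ∀ n, Integrable (Y n) P) [IsProbabilityMeasure P] {θ : ℕ → ℝ} {c : ℝ}
    (h : Tendsto (fun n => ∫ ω, |Y n ω - θ n| ∂P) atTop (𝓝 0)) (hθ : Tendsto θ atTop (𝓝 c)) :
    TendstoInMeasure P Y atTop fun _ => c := by
  refine tendstoInMeasure_of_tendsto_eLpNorm one_ne_zero (fun n => (hY n).aestronglyMeasurable)
    aestronglyMeasurable_const ?_
  have hsum : Tendsto (fun n => ∫ ω, |Y n ω - θ n| ∂P + |θ n - c|) atTop (𝓝 0) := by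
    have := (tendsto_iff_norm_sub_tendsto_zero.1 hθ)
    simpa using h.add this
  have hofReal := ENNReal.tendsto_ofReal hsum
  rw [ENNReal.ofReal_zero] at hofReal
  refine tendsto_of_tendsto_of_tendsto_of_le_of_le tendsto_const_nhds hofReal
    (fun _ => zero_le) fun n => ?_
  have hI : Integrable (fun ω => Y n ω - θ n) P := (hY n).sub (integrable_const _)
  have hI' : Integrable (Y n - fun _ => c) P := (hY n).sub (integrable_const _)
  rw [eLpNorm_one_eq_lintegral_enorm, ← ofReal_integral_norm_eq_lintegral_enorm hI']
  refine ENNReal.ofReal_le_ofReal ?_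
  have e : ∫ ω, |Y n ω - θ n| ∂P + |θ n - c| = ∫ ω, (|Y n ω - θ n| + |θ n - c|) ∂P := by
    rw [integral_add hI.abs (integrable_const _)]
    simp
  rw [e]
  refine integral_mono hI'.norm (hI.abs.add (integrable_const _)) fun ω => ?_
  have := abs_add_le (Y n ω - θ n) (θ n - c)
  rw [sub_add_sub_cancel] at this
  exact this

end InMeasure

/-! ### Stability of the lasso minimiser -/

section Argmin

variable {p p' n' : ℕ} {ψ : Cov p → Fin p' → ℝ} {z' : Fin n' → Cov p}

theorem continuous_lassoCriterion :
    Continuous fun q : ((Fin n' → ℝ) × ℝ) × (Fin p' → ℝ) =>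
      lassoCriterion ψ z' q.1.1 q.1.2 q.2 := by
  unfold lassoCriterion l1norm dotProduct
  fun_prop

theorem limitCriterion_eq_lassoCriterion (βstar : Fin p' → ℝ) (lam₀ : ℝ) :
    limitCriterion ψ z' βstar lam₀ =
      lassoCriterion ψ z' (fun i => ψ (z' i) ⬝ᵥ βstar) lam₀ := by
  ext β
  simp only [limitCriterion, lassoCriterion, dotProduct_sub]

theorem convexOn_lassoCriterion (Y : Fin n' → ℝ) {lam : ℝ} (hlam : 0 ≤ lam) :
    ConvexOn ℝ univ (lassoCriterion ψ z' Y lam) := by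
  refine ⟨convex_univ, fun β₁ _ β₂ _ a b ha hb hab => ?_⟩
  have hsq : ∀ i, (Y i - ψ (z' i) ⬝ᵥ (a • β₁ + b • β₂)) ^ 2 ≤
      a * (Y i - ψ (z' i) ⬝ᵥ β₁) ^ 2 + b * (Y i - ψ (z' i) ⬝ᵥ β₂) ^ 2 := fun i => by
    have e : Y i - ψ (z' i) ⬝ᵥ (a • β₁ + b • β₂) =
        a * (Y i - ψ (z' i) ⬝ᵥ β₁) + b * (Y i - ψ (z' i) ⬝ᵥ β₂) := by
      rw [dotProduct_add, dotProduct_smul, dotProduct_smul, smul_eq_mul, smul_eq_mul]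
      linear_combination (-Y i) * hab
    rw [e]
    have := (even_two.convexOn_pow (𝕜 := ℝ)).2 (mem_univ (Y i - ψ (z' i) ⬝ᵥ β₁))
      (mem_univ (Y i - ψ (z' i) ⬝ᵥ β₂)) ha hb hab
    simpa only [smul_eq_mul] using this
  have hl1 : l1norm (a • β₁ + b • β₂) ≤ a * l1norm β₁ + b * l1norm β₂ := by
    simp only [l1norm, Finset.mul_sum, ← Finset.sum_add_distrib]
    refine Finset.sum_le_sum fun j _ => ?_
    refine (abs_add_le _ _).trans (le_of_eq ?_)
    simp [abs_mul, abs_of_nonneg ha, abs_of_nonneg hb]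
  have hs := Finset.sum_le_sum fun i (_ : i ∈ Finset.univ) => hsq i
  rw [Finset.sum_add_distrib, ← Finset.mul_sum, ← Finset.mul_sum] at hs
  have hs' := mul_le_mul_of_nonneg_left hs (by positivity : (0 : ℝ) ≤ 1 / (n' : ℝ))
  have hl1' := mul_le_mul_of_nonneg_left hl1 hlam
  simp only [lassoCriterion, smul_eq_mul]
  linarith

/-- A strict inequality with a fixed point of comparison persists over a compact set. -/
theorem eventually_forall_lt_of_isCompact {A B : Type*} [TopologicalSpace A] [TopologicalSpace B]
    {L : A × B → ℝ} (hL : Continuous L) {a₀ : A} {b₀ : B} {s : Set B} (hs : IsCompact s)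
    (hlt : ∀ b ∈ s, L (a₀, b₀) < L (a₀, b)) :
    ∀ᶠ a in 𝓝 a₀, ∀ b ∈ s, L (a, b₀) < L (a, b) := by
  refine hs.eventually_forall_of_forall_eventually (P := fun a b => L (a, b₀) < L (a, b))
    fun b hb => ?_
  have hc : Continuous fun r : A × B => L (r.1, b₀) := by fun_prop
  exact hc.continuousAt.eventually_lt hL.continuousAt (hlt b hb)

/-- Minimisers of the penalised criterion depend continuously on the responses and the penalty
level at a point where the minimiser is unique. -/
theorem eventually_dist_lt_of_isMinOn_lassoCriterion {Y₀ : Fin n' → ℝ} {lam₀ : ℝ}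
    {βss : Fin p' → ℝ}
    (hmin : ∀ β, β ≠ βss → lassoCriterion ψ z' Y₀ lam₀ βss < lassoCriterion ψ z' Y₀ lam₀ β)
    {ε : ℝ} (hε : 0 < ε) :
    ∀ᶠ q : (Fin n' → ℝ) × ℝ in 𝓝 (Y₀, lam₀), 0 ≤ q.2 → ∀ β,
      IsMinOn (lassoCriterion ψ z' q.1 q.2) univ β → dist β βss < ε := by
  have hsphere : ∀ᶠ q : (Fin n' → ℝ) × ℝ in 𝓝 (Y₀, lam₀), ∀ β ∈ Metric.sphere βss ε,
      lassoCriterion ψ z' q.1 q.2 βss < lassoCriterion ψ z' q.1 q.2 β := by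
    refine eventually_forall_lt_of_isCompact (continuous_lassoCriterion (ψ := ψ) (z' := z'))
      (isCompact_sphere βss ε) fun β hβ => hmin β fun h => ?_
    simp [h, hε.ne] at hβ
  filter_upwards [hsphere] with q hq hlam β hβ
  by_contra hfar
  rw [not_lt] at hfar
  have hd : 0 < dist β βss := hε.trans_le hfar
  set t := ε / dist β βss with ht
  have ht0 : 0 < t := div_pos hε hd
  have ht1 : t ≤ 1 := (div_le_one hd).2 hfar
  -- The segment from `βss` to a distant minimiser crosses the sphere. By convexity the criterion at
  -- the crossing is at most its value at `βss`, against the strict inequality on the sphere.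
  have hmem : (1 - t) • βss + t • β ∈ Metric.sphere βss ε := by
    have e : (1 - t) • βss + t • β - βss = t • (β - βss) := by
      rw [sub_smul, one_smul, smul_sub]; abel
    rw [mem_sphere_iff_norm, e, norm_smul, Real.norm_of_nonneg ht0.le, ← dist_eq_norm, ht,
      div_mul_cancel₀ _ hd.ne']
  have h1 := hq _ hmem
  have h2 := (convexOn_lassoCriterion (ψ := ψ) (z' := z') q.1 hlam).2 (mem_univ βss) (mem_univ β)
    (sub_nonneg.2 ht1) ht0.le (by ring)
  have h3 := hβ (mem_univ βss)
  simp only [smul_eq_mul, mem_ofPred_eq] at h2 h3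
  nlinarith

/-- If all summands vanished, `βstar - β` would be orthogonal to the span of the design vectors,
hence to itself. -/
theorem limitCriterion_zero_lt_of_span_eq_top {βstar : Fin p' → ℝ} (hn' : 0 < n')
    (hspan : Submodule.span ℝ (range fun i => ψ (z' i)) = ⊤) {β : Fin p' → ℝ} (hβ : β ≠ βstar) :
    limitCriterion ψ z' βstar 0 βstar < limitCriterion ψ z' βstar 0 β := by
  have hne : ∃ i, ψ (z' i) ⬝ᵥ (βstar - β) ≠ 0 := by
    by_contra hall
    push Not at hall
    have hle : Submodule.span ℝ (range fun i => ψ (z' i)) ≤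
        LinearMap.ker ((dotProductBilin ℝ ℝ).flip (βstar - β)) := by
      rw [Submodule.span_le]
      rintro _ ⟨i, rfl⟩
      simpa using hall i
    rw [hspan, top_le_iff] at hle
    have hz : (βstar - β) ⬝ᵥ (βstar - β) = 0 := by
      have : βstar - β ∈ LinearMap.ker ((dotProductBilin ℝ ℝ).flip (βstar - β)) := by
        rw [hle]; trivial
      simpa using this
    exact hβ (sub_eq_zero.1 (dotProduct_self_eq_zero.1 hz)).symm
  obtain ⟨i, hi⟩ := hne
  simp only [limitCriterion, sub_self, dotProduct_zero, zero_mul, add_zero]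
  have hpos : 0 < ∑ i, (ψ (z' i) ⬝ᵥ (βstar - β)) ^ 2 :=
    Finset.sum_pos' (fun _ _ => sq_nonneg _) ⟨i, Finset.mem_univ _, by positivity⟩
  simp only [ne_eq, OfNat.ofNat_ne_zero, not_false_eq_true, zero_pow, Finset.sum_const_zero,
    mul_zero]
  positivity

end Argmin

/-! ### Limits of the moments of the localised kernel -/

section LocalMoments

variable {p : ℕ} {fZ : Cov p → ℝ} [IsProbabilityMeasure (covLaw fZ)]
  {K : Cov p → ℝ} {C : ℝ} {h : ℕ → ℝ} {z : Cov p}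

theorem measurable_localKernel (hK_meas : Measurable K) (n : ℕ) :
    Measurable fun u => scaledKernel K (h n) (u - z) :=
  (measurable_scaledKernel hK_meas _).comp (measurable_id.sub_const z)

theorem tendsto_integral_localKernel (hfZ_meas : Measurable fZ) (hfZ_nonneg : ∀ z, 0 ≤ fZ z)
    (h_fcont : ContinuousAt fZ z) (hK_meas : Measurable K) (hC : ∀ u, |K u| ≤ C)
    (hKint : Integrable K) (hK1 : ∫ u, K u = 1) (hKpos : 0 < ∫ u, |K u|)
    (hK_tail : Tendsto (fun t : Cov p => K t * ‖t‖ ^ p) (cocompact (Cov p)) (𝓝 0))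
    (h_pos : ∀ n, 0 < h n) (h_zero : Tendsto h atTop (𝓝 0)) :
    Tendsto (fun n => ∫ u, scaledKernel K (h n) (u - z) ∂(covLaw fZ)) atTop (𝓝 (fZ z)) := by
  have := tendsto_integral_scaledKernel_mul hK_meas hC hKint hKpos hK_tail h_pos h_zero
    (integrable_density hfZ_meas hfZ_nonneg) h_fcont
  rw [hK1, one_mul] at this
  exact this.congr fun n => (integral_covLaw hfZ_meas hfZ_nonneg _).symm

theorem tendsto_integral_abs_localKernel (hfZ_meas : Measurable fZ)
    (hfZ_nonneg : ∀ z, 0 ≤ fZ z) (h_fcont : ContinuousAt fZ z) (hKpos : 0 < ∫ u, |K u|)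
    (hK_tail : Tendsto (fun t : Cov p => K t * ‖t‖ ^ p) (cocompact (Cov p)) (𝓝 0))
    (h_pos : ∀ n, 0 < h n) (h_zero : Tendsto h atTop (𝓝 0)) :
    Tendsto (fun n => ∫ u, |scaledKernel K (h n) (u - z)| ∂(covLaw fZ)) atTop
      (𝓝 ((∫ u, |K u|) * fZ z)) := by
  have := tendsto_integral_abs_scaledKernel_mul hKpos hK_tail h_pos h_zero
    (integrable_density hfZ_meas hfZ_nonneg) h_fcont
  exact this.congr fun n => (integral_covLaw hfZ_meas hfZ_nonneg _).symm

/-- The approximate identity is applied to `fZ` cut off to `sᶜ`. This function vanishes near `z`, so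
it is continuous there with value `0`, whatever `fZ` does. -/
theorem tendsto_integral_abs_localKernel_compl (hfZ_meas : Measurable fZ)
    (hfZ_nonneg : ∀ z, 0 ≤ fZ z) (hKpos : 0 < ∫ u, |K u|)
    (hK_tail : Tendsto (fun t : Cov p => K t * ‖t‖ ^ p) (cocompact (Cov p)) (𝓝 0))
    (h_pos : ∀ n, 0 < h n) (h_zero : Tendsto h atTop (𝓝 0)) {s : Set (Cov p)}
    (hs : MeasurableSet s) (hsz : s ∈ 𝓝 z) :
    Tendsto (fun n => ∫ u, |scaledKernel K (h n) (u - z)| * sᶜ.indicator 1 u ∂(covLaw fZ))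
      atTop (𝓝 0) := by
  have hzero : sᶜ.indicator fZ z = 0 := indicator_of_notMem (by simpa using mem_of_mem_nhds hsz) _
  have hcont : ContinuousAt (sᶜ.indicator fZ) z := by
    refine (continuousAt_const (y := (0 : ℝ))).congr ?_
    filter_upwards [hsz] with u hu
    exact (indicator_of_notMem (by simpa using hu) _).symm
  have := tendsto_integral_abs_scaledKernel_mul hKpos hK_tail h_pos h_zero
    ((integrable_density hfZ_meas hfZ_nonneg).indicator hs.compl) hcont
  rw [hzero, mul_zero] at this
  refine this.congr fun n => ?_
  rw [integral_covLaw hfZ_meas hfZ_nonneg]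
  congr 1 with u
  by_cases hu : u ∈ sᶜ
  · simp [indicator_of_mem hu]
  · simp [indicator_of_notMem hu]

/-- One factor of the square is bounded by `(h n ^ p)⁻¹ * C`, the other has bounded `L¹` norm; the
quotient is thus of order `1 / (n * h n ^ p)`. -/
theorem tendsto_integral_sq_localKernel_div (hfZ_meas : Measurable fZ)
    (hfZ_nonneg : ∀ z, 0 ≤ fZ z) (h_fcont : ContinuousAt fZ z) (hK_meas : Measurable K)
    (hC : ∀ u, |K u| ≤ C) (hKpos : 0 < ∫ u, |K u|)
    (hK_tail : Tendsto (fun t : Cov p => K t * ‖t‖ ^ p) (cocompact (Cov p)) (𝓝 0))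
    (h_pos : ∀ n, 0 < h n) (h_zero : Tendsto h atTop (𝓝 0))
    (h_rate : Tendsto (fun n : ℕ => (n : ℝ) * h n ^ p) atTop atTop) :
    Tendsto (fun n : ℕ => (∫ u, scaledKernel K (h n) (u - z) ^ 2 ∂(covLaw fZ)) / n) atTop
      (𝓝 0) := by
  have hA := tendsto_integral_abs_localKernel hfZ_meas hfZ_nonneg h_fcont hKpos hK_tail
    h_pos h_zero
  have hlim := (h_rate.inv_tendsto_atTop.mul_const C).mul hA
  simp only [zero_mul] at hlim
  refine squeeze_zero (fun n => div_nonneg (integral_nonneg fun _ => sq_nonneg _)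
    (Nat.cast_nonneg n)) (fun n => ?_) hlim
  have hm : Measurable fun u => scaledKernel K (h n) (u - z) := measurable_localKernel hK_meas n
  have hI : Integrable (fun u => |scaledKernel K (h n) (u - z)|) (covLaw fZ) :=
    (integrable_of_abs_le hm fun u => abs_scaledKernel_le hC (h_pos n) _).abs
  have hle : ∫ u, scaledKernel K (h n) (u - z) ^ 2 ∂(covLaw fZ) ≤
      (h n ^ p)⁻¹ * C * ∫ u, |scaledKernel K (h n) (u - z)| ∂(covLaw fZ) := by
    rw [← integral_const_mul]
    refine integral_mono_of_nonneg (ae_of_all _ fun _ => sq_nonneg _) (hI.const_mul _)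
      (ae_of_all _ fun u => ?_)
    simp only
    rw [← sq_abs, sq]
    exact mul_le_mul_of_nonneg_right (abs_scaledKernel_le hC (h_pos n) _) (abs_nonneg _)
  refine (div_le_div_of_nonneg_right hle (Nat.cast_nonneg n)).trans (le_of_eq ?_)
  rw [Pi.inv_apply, mul_inv]
  ring

/-- The mean of the localised centred concordance function tends to zero. -/
theorem tendsto_integral_localKernel_condTau {κ : Kernel (Cov p) (ℝ × ℝ)} [IsMarkovKernel κ]
    (hfZ_meas : Measurable fZ) (hfZ_nonneg : ∀ z, 0 ≤ fZ z) (h_fcont : ContinuousAt fZ z)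
    (h_taucont : ContinuousAt (fun q : Cov p × Cov p => condTauPair κ q.1 q.2) (z, z))
    (hK_meas : Measurable K) (hC : ∀ u, |K u| ≤ C) (hKpos : 0 < ∫ u, |K u|)
    (hK_tail : Tendsto (fun t : Cov p => K t * ‖t‖ ^ p) (cocompact (Cov p)) (𝓝 0))
    (h_pos : ∀ n, 0 < h n) (h_zero : Tendsto h atTop (𝓝 0)) :
    Tendsto (fun n => ∫ u, scaledKernel K (h n) (u - z) * ∫ v, scaledKernel K (h n) (v - z) *
      (condTauPair κ u v - condKendallTau κ z) ∂(covLaw fZ) ∂(covLaw fZ)) atTop (𝓝 0) := by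
  have hA := tendsto_integral_abs_localKernel hfZ_meas hfZ_nonneg h_fcont hKpos hK_tail
    h_pos h_zero
  set L := (∫ u, |K u|) * fZ z
  refine Metric.tendsto_nhds.2 fun ε hε => ?_
  simp only [Real.dist_0_eq_abs]
  -- The weighted bound tends to `ε' * L ^ 2`; the added `1` keeps this strictly below `ε` and the
  -- denominator positive.
  set ε' := ε / (L ^ 2 + 1)
  have hL : 0 < L ^ 2 + 1 := by positivity
  have hε' : 0 < ε' := div_pos hε hL
  obtain ⟨s₁, hs₁, s₂, hs₂, hs⟩ := mem_nhds_prod_iff.1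
    (h_taucont (Metric.ball_mem_nhds _ hε'))
  obtain ⟨δ, hδ, hball⟩ := Metric.mem_nhds_iff.1 (inter_mem hs₁ hs₂)
  have hA' := tendsto_integral_abs_localKernel_compl (fZ := fZ) hfZ_meas hfZ_nonneg hKpos hK_tail
    h_pos h_zero (measurableSet_ball (x := z) (ε := δ)) (Metric.ball_mem_nhds z hδ)
  have hlim := ((hA.pow 2).const_mul ε').add ((hA.const_mul 4).mul hA')
  rw [mul_zero, add_zero] at hlim
  have hlt : ε' * L ^ 2 < ε := by
    calc ε' * L ^ 2 < ε' * (L ^ 2 + 1) := by nlinarith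
      _ = ε := div_mul_cancel₀ _ hL.ne'
  filter_upwards [hlim.eventually_lt_const hlt] with n hn
  refine (abs_integral_integral_weighted_le (measurable_localKernel hK_meas n)
    (fun u => abs_scaledKernel_le hC (h_pos n) _) (fun u v => ?_) measurableSet_ball hε'.le
    fun u hu v hv => ?_).trans_lt hn
  · have h1 := abs_le.1 (abs_condTauPair_le (κ := κ) u v)
    have h2 := abs_le.1 (abs_condTauPair_le (κ := κ) z z)
    rw [condKendallTau, abs_le]
    constructor <;> linarith
  · have : (u, v) ∈ s₁ ×ˢ s₂ := ⟨(hball hu).1, (hball hv).2⟩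
    have := hs this
    simp only [mem_preimage, Metric.mem_ball, Real.dist_eq] at this
    exact this.le

end LocalMoments

/-! ### Algebra of the estimator and the marginal law -/

theorem sqrt_natCast_mul_eq {n : ℕ} (hn : 0 < n) {x : ℝ} :
    √(n * x) = n * √(x / n) := by
  have hn' : (0 : ℝ) < n := Nat.cast_pos.2 hn
  have : (n : ℝ) * x = n ^ 2 * (x / n) := by field_simp
  rw [this, Real.sqrt_mul (by positivity), Real.sqrt_sq hn'.le]

/-- The kernel estimator in terms of the symmetrised, centred double sum. -/
theorem tauHat_eq_div {p : ℕ} (K : Cov p → ℝ) (h : ℝ) (g : ℝ × ℝ → ℝ × ℝ → ℝ) (n : ℕ)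
    (Z : ℕ → Cov p) (X : ℕ → ℝ × ℝ) (z : Cov p) (t : ℝ) :
    tauHat K h g n Z X z =
      (((n : ℝ) ^ 2)⁻¹ * ∑ i ∈ Finset.range n, ∑ j ∈ Finset.range n,
        scaledKernel K h (Z i - z) * scaledKernel K h (Z j - z) *
          (symmetrization g (X i) (X j) - t) +
        t * ((n : ℝ)⁻¹ * ∑ i ∈ Finset.range n, scaledKernel K h (Z i - z)) ^ 2) /
      ((n : ℝ)⁻¹ * ∑ i ∈ Finset.range n, scaledKernel K h (Z i - z)) ^ 2 := by
  -- For `n = 0` both sides are `0` by the convention for division by zero.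
  rcases Nat.eq_zero_or_pos n with rfl | hn
  · simp [tauHat]
  have hn' : (n : ℝ) ≠ 0 := (Nat.cast_pos.2 hn).ne'
  set k : ℕ → ℝ := fun i => scaledKernel K h (Z i - z) with hk
  set σ := ∑ i ∈ Finset.range n, k i with hσ
  have hsq : ∑ i ∈ Finset.range n, ∑ j ∈ Finset.range n, k i * k j * t = t * σ ^ 2 := by
    rw [sq, hσ, Finset.sum_mul_sum, Finset.mul_sum]
    refine Finset.sum_congr rfl fun i _ => ?_
    rw [Finset.mul_sum]
    exact Finset.sum_congr rfl fun j _ => by ring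
  have hsymm : ∑ i ∈ Finset.range n, ∑ j ∈ Finset.range n,
      k i * k j * symmetrization g (X i) (X j) =
      ∑ i ∈ Finset.range n, ∑ j ∈ Finset.range n, k i * k j * g (X i) (X j) := by
    have hswap : ∑ i ∈ Finset.range n, ∑ j ∈ Finset.range n, k i * k j * g (X j) (X i) =
        ∑ i ∈ Finset.range n, ∑ j ∈ Finset.range n, k i * k j * g (X i) (X j) := by
      rw [Finset.sum_comm]
      exact Finset.sum_congr rfl fun i _ => Finset.sum_congr rfl fun j _ => by ring
    have : ∑ i ∈ Finset.range n, ∑ j ∈ Finset.range n,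
        k i * k j * symmetrization g (X i) (X j) =
        (∑ i ∈ Finset.range n, ∑ j ∈ Finset.range n, k i * k j * g (X i) (X j) +
          ∑ i ∈ Finset.range n, ∑ j ∈ Finset.range n, k i * k j * g (X j) (X i)) / 2 := by
      rw [← Finset.sum_add_distrib, Finset.sum_div]
      refine Finset.sum_congr rfl fun i _ => ?_
      rw [← Finset.sum_add_distrib, Finset.sum_div]
      exact Finset.sum_congr rfl fun j _ => by rw [symmetrization]; ring
    rw [this, hswap]
    ring
  -- No case `σ = 0` is split off: both sides are then `0`, so the identity holds surely and no
  -- exceptional event has to be handled.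
  have hL : tauHat K h g n Z X z =
      (∑ i ∈ Finset.range n, ∑ j ∈ Finset.range n, k i * k j * g (X i) (X j)) / σ ^ 2 := by
    rw [tauHat, Finset.sum_div]
    refine Finset.sum_congr rfl fun i _ => ?_
    rw [Finset.sum_div]
    refine Finset.sum_congr rfl fun j _ => ?_
    simp only [kernelWeight]
    rw [div_mul_div_comm, ← sq]
    ring
  simp only [mul_sub, Finset.sum_sub_distrib]
  rw [hsq, hsymm, hL, mul_pow, inv_pow]
  have e : ∀ a b : ℝ, ((n : ℝ) ^ 2)⁻¹ * a - ((n : ℝ) ^ 2)⁻¹ * (t * b)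
      + t * (((n : ℝ) ^ 2)⁻¹ * b) = ((n : ℝ) ^ 2)⁻¹ * a := fun a b => by ring
  rw [e, mul_div_mul_left _ _ (inv_ne_zero (pow_ne_zero 2 hn'))]

theorem map_covariate_eq {Ω : Type*} [MeasurableSpace Ω] {P : Measure Ω} {p : ℕ}
    {Z : ℕ → Ω → Cov p} {X : ℕ → Ω → ℝ × ℝ} {fZ : Cov p → ℝ} {κ : Kernel (Cov p) (ℝ × ℝ)}
    [IsMarkovKernel κ] [SFinite (covLaw fZ)] (hX : ∀ i, Measurable (X i))
    (h_law : ∀ i, P.map (fun ω => (Z i ω, X i ω)) = Measure.compProd (covLaw fZ) κ) (i : ℕ) :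
    P.map (Z i) = covLaw fZ := by
  rw [← Measure.fst_compProd (covLaw fZ) κ, ← h_law i, Measure.fst_map_prodMk (hX i)]

/-! ### Consistency of the kernel estimators -/

section Consistency

variable {Ω : Type*} [MeasurableSpace Ω] {P : Measure Ω} [IsProbabilityMeasure P] {p : ℕ}
  {Z : ℕ → Ω → Cov p} {X : ℕ → Ω → ℝ × ℝ} {fZ : Cov p → ℝ} {κ : Kernel (Cov p) (ℝ × ℝ)}
  [IsMarkovKernel κ] {K : Cov p → ℝ} {C : ℝ} {h : ℕ → ℝ} {g : ℝ × ℝ → ℝ × ℝ → ℝ} {z : Cov p}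

/-- Consistency of the kernel density estimator. -/
theorem tendstoInMeasure_densityEstimator (hZ : ∀ i, Measurable (Z i))
    (h_indep : iIndepFun Z P) (hfZ_meas : Measurable fZ) (hfZ_nonneg : ∀ z, 0 ≤ fZ z)
    (h_law : ∀ i, P.map (Z i) = covLaw fZ)
    (h_fcont : ContinuousAt fZ z) (hK_meas : Measurable K) (hC : ∀ u, |K u| ≤ C)
    (hKint : Integrable K) (hK1 : ∫ u, K u = 1) (hKpos : 0 < ∫ u, |K u|)
    (hK_tail : Tendsto (fun t : Cov p => K t * ‖t‖ ^ p) (cocompact (Cov p)) (𝓝 0))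
    (h_pos : ∀ n, 0 < h n) (h_zero : Tendsto h atTop (𝓝 0))
    (h_rate : Tendsto (fun n : ℕ => (n : ℝ) * h n ^ p) atTop atTop) :
    TendstoInMeasure P (fun (n : ℕ) ω => (n : ℝ)⁻¹ *
      ∑ i ∈ Finset.range n, scaledKernel K (h n) (Z i ω - z)) atTop fun _ => fZ z := by
  have : IsProbabilityMeasure (covLaw fZ) := by
    rw [← h_law 0]; exact Measure.isProbabilityMeasure_map (hZ 0).aemeasurable
  have hmeas : ∀ n, Measurable fun u => scaledKernel K (h n) (u - z) :=
    fun n => measurable_localKernel hK_meas n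
  have hint : ∀ n i, Integrable (fun ω => scaledKernel K (h n) (Z i ω - z)) P := fun n i =>
    integrable_of_abs_le ((hmeas n).comp (hZ i)) fun ω => abs_scaledKernel_le hC (h_pos n) _
  refine tendstoInMeasure_const_of_integral_abs_sub
    (fun n => (integrable_finsetSum _ fun i _ => hint n i).const_mul _) ?_
    (tendsto_integral_localKernel hfZ_meas hfZ_nonneg h_fcont hK_meas hC hKint hK1 hKpos hK_tail
      h_pos h_zero)
  have hS := (Real.continuous_sqrt.tendsto 0).comp
    (tendsto_integral_sq_localKernel_div hfZ_meas hfZ_nonneg h_fcont hK_meas hC hKpos hK_tail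
      h_pos h_zero h_rate)
  rw [Real.sqrt_zero] at hS
  refine squeeze_zero' (Eventually.of_forall fun n => integral_nonneg fun _ => abs_nonneg _)
    ?_ hS
  filter_upwards [eventually_gt_atTop 0] with n hn
  have hn' : (0 : ℝ) < n := Nat.cast_pos.2 hn
  have hb := integral_abs_sum_sub_le hZ h_indep h_law (hmeas n)
    (fun u => abs_scaledKernel_le hC (h_pos n) _) (Finset.range n)
  rw [Finset.card_range, sqrt_natCast_mul_eq hn] at hb
  rw [Function.comp_apply]
  refine le_of_mul_le_mul_left ?_ hn'
  refine le_trans (le_of_eq ?_) hb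
  rw [← integral_const_mul]
  congr 1 with ω
  rw [Finset.sum_sub_distrib, Finset.sum_const, Finset.card_range, nsmul_eq_mul,
    ← abs_of_pos hn', ← abs_mul, abs_of_pos hn', mul_sub, mul_inv_cancel_left₀ hn'.ne']

/-- The localised, centred double sum of concordance indicators vanishes in probability. -/
theorem tendstoInMeasure_centredDoubleSum (hZ : ∀ i, Measurable (Z i))
    (hX : ∀ i, Measurable (X i)) (h_indep : iIndepFun (fun i ω => (Z i ω, X i ω)) P)
    (hfZ_meas : Measurable fZ) (hfZ_nonneg : ∀ z, 0 ≤ fZ z)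
    [IsProbabilityMeasure (covLaw fZ)]
    (h_law : ∀ i, P.map (fun ω => (Z i ω, X i ω)) = Measure.compProd (covLaw fZ) κ)
    (h_margins : ∀ z t, κ z {x | x.1 = t} = 0 ∧ κ z {x | x.2 = t} = 0)
    (h_fcont : ContinuousAt fZ z)
    (h_taucont : ContinuousAt (fun q : Cov p × Cov p => condTauPair κ q.1 q.2) (z, z))
    (hK_meas : Measurable K) (hC : ∀ u, |K u| ≤ C) (hKpos : 0 < ∫ u, |K u|)
    (hK_tail : Tendsto (fun t : Cov p => K t * ‖t‖ ^ p) (cocompact (Cov p)) (𝓝 0))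
    (h_pos : ∀ n, 0 < h n) (h_zero : Tendsto h atTop (𝓝 0))
    (h_rate : Tendsto (fun n : ℕ => (n : ℝ) * h n ^ p) atTop atTop)
    (hg : g = gOne ∨ g = gTwo ∨ g = gThree) :
    TendstoInMeasure P (fun (n : ℕ) ω => ((n : ℝ) ^ 2)⁻¹ *
      ∑ i ∈ Finset.range n, ∑ j ∈ Finset.range n,
        scaledKernel K (h n) (Z i ω - z) * scaledKernel K (h n) (Z j ω - z) *
          (symmetrization g (X i ω) (X j ω) - condKendallTau κ z)) atTop fun _ => 0 := by
  set τ := condKendallTau κ z with hτ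
  have hW : ∀ i, Measurable fun ω => (Z i ω, X i ω) := fun i => (hZ i).prodMk (hX i)
  have hk : ∀ n, Measurable fun u => scaledKernel K (h n) (u - z) :=
    fun n => measurable_localKernel hK_meas n
  have hkW : ∀ n, Measurable fun w : Cov p × (ℝ × ℝ) => scaledKernel K (h n) (w.1 - z) :=
    fun n => (hk n).comp measurable_fst
  have hkC : ∀ n (u : Cov p), |scaledKernel K (h n) (u - z)| ≤ (h n ^ p)⁻¹ * C :=
    fun n u => abs_scaledKernel_le hC (h_pos n) _
  have hG : Measurable (Function.uncurry fun x y : ℝ × ℝ => symmetrization g x y - τ) :=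
    (measurable_symmetrization hg).sub_const τ
  have hτ1 : |τ| ≤ 1 := abs_condTauPair_le z z
  -- The bound `B = 4` is `3` for the symmetrised function plus `1` for tau.
  have hGB : ∀ x y, |symmetrization g x y - τ| ≤ 4 := fun x y =>
    (abs_sub _ _).trans (by linarith [abs_symmetrization_le hg x y])
  have hGW : Measurable (Function.uncurry fun w w' : Cov p × (ℝ × ℝ) =>
      symmetrization g w.2 w'.2 - τ) :=
    hG.comp ((measurable_snd.comp measurable_fst).prodMk (measurable_snd.comp measurable_snd))
  have hsymm : ∀ u v, ∫ x, ∫ y, (symmetrization g x y - τ) ∂(κ v) ∂(κ u) =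
      condTauPair κ u v - τ := fun u v => by
    have hint : ∀ x, Integrable (fun y => symmetrization g x y) (κ v) := fun x =>
      integrable_of_abs_le ((measurable_symmetrization hg).comp measurable_prodMk_left)
        fun y => abs_symmetrization_le hg x y
    have hint' : Integrable (fun x => ∫ y, symmetrization g x y ∂(κ v)) (κ u) := by
      refine integrable_of_abs_le (C := 3) (StronglyMeasurable.integral_prod_right (ν := κ v)
        (measurable_symmetrization hg).stronglyMeasurable).measurable fun x => ?_
      simpa using norm_integral_le_of_norm_le_const (μ := κ v)
        (ae_of_all _ (abs_symmetrization_le hg x) : ∀ᵐ y ∂(κ v), ‖symmetrization g x y‖ ≤ 3)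
    simp only [fun x => integral_sub (hint x) (integrable_const τ)]
    rw [integral_sub hint' (integrable_const _), integral_symmetrization hg h_margins]
    simp
  have hθ : ∀ n, ∫ w, scaledKernel K (h n) (w.1 - z) * ∫ w', scaledKernel K (h n) (w'.1 - z) *
      (symmetrization g w.2 w'.2 - τ) ∂(Measure.compProd (covLaw fZ) κ)
        ∂(Measure.compProd (covLaw fZ) κ) =
      ∫ u, scaledKernel K (h n) (u - z) * ∫ v, scaledKernel K (h n) (v - z) *
        (condTauPair κ u v - τ) ∂(covLaw fZ) ∂(covLaw fZ) := fun n => by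
    rw [integral_compProd_weighted (hk n) (hkC n) hG hGB]
    simp only [hsymm]
  refine tendstoInMeasure_const_of_integral_abs_sub (fun n => ?_) ?_
    (tendsto_integral_localKernel_condTau hfZ_meas hfZ_nonneg h_fcont h_taucont hK_meas hC
      hKpos hK_tail h_pos h_zero)
  · refine (integrable_finsetSum _ fun i _ => integrable_finsetSum _ fun j _ => ?_).const_mul _
    refine integrable_of_abs_le ((((hk n).comp (hZ i)).mul ((hk n).comp (hZ j))).mul
      (hG.comp ((hX i).prodMk (hX j)))) (C := (h n ^ p)⁻¹ * C * ((h n ^ p)⁻¹ * C) * 4)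
      fun ω => ?_
    have hC0 : 0 ≤ (h n ^ p)⁻¹ * C := (abs_nonneg _).trans (hkC n z)
    rw [abs_mul, abs_mul]
    exact mul_le_mul (mul_le_mul (hkC n _) (hkC n _) (abs_nonneg _) hC0) (hGB _ _) (abs_nonneg _)
      (mul_nonneg hC0 hC0)
  have hA := tendsto_integral_abs_localKernel hfZ_meas hfZ_nonneg h_fcont hKpos hK_tail
    h_pos h_zero
  have hS := tendsto_integral_sq_localKernel_div hfZ_meas hfZ_nonneg h_fcont hK_meas hC hKpos
    hK_tail h_pos h_zero h_rate
  have hsqrt : ∀ {x : ℕ → ℝ}, Tendsto x atTop (𝓝 0) →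
      Tendsto (fun n => √(x n)) atTop (𝓝 0) := fun hx => by
    have := (Real.continuous_sqrt.tendsto 0).comp hx
    rwa [Real.sqrt_zero] at this
  -- The limits `h1` to `h4` are those of the four terms of `integral_abs_vStatistic_sub_le` with `B
  -- = 4`, divided by `n ^ 2`.
  have h1 := hA.mul (hsqrt (by simpa using hS.const_mul ((4 : ℝ) ^ 2)))
  have h2 := hsqrt (by simpa using ((hA.const_mul 4).pow 2).mul hS)
  have h3 := hS.const_mul 4
  have h4 := ((hA.const_mul 4).mul hA).mul (tendsto_inv_atTop_nhds_zero_nat (𝕜 := ℝ))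
  have hlim := ((h1.add h2).add h3).add h4
  simp only [mul_zero, add_zero] at hlim
  refine squeeze_zero' (Eventually.of_forall fun n => integral_nonneg fun _ => abs_nonneg _)
    ?_ hlim
  filter_upwards [eventually_gt_atTop 0] with n hn
  have hn' : (0 : ℝ) < n := Nat.cast_pos.2 hn
  have hb := integral_abs_vStatistic_sub_le hW h_indep h_law (hkW n) (fun w => hkC n w.1) hGW
    (fun w w' => hGB _ _) n
  rw [hθ n, integral_fst_compProd (hk n).abs, integral_fst_compProd ((hk n).pow_const 2),
    sqrt_natCast_mul_eq hn, sqrt_natCast_mul_eq hn] at hb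
  refine le_of_mul_le_mul_left ?_ (pow_pos hn' 2)
  refine (le_of_eq ?_).trans (hb.trans (le_of_eq ?_))
  · rw [← integral_const_mul]
    congr 1 with ω
    rw [← abs_of_pos (pow_pos hn' 2), ← abs_mul, abs_of_pos (pow_pos hn' 2), mul_sub,
      mul_inv_cancel_left₀ (pow_pos hn' 2).ne']
  · rw [mul_div_assoc, mul_div_assoc]
    field_simp

/-- Consistency of the kernel estimator of the conditional Kendall's tau, Borel kernels. -/
theorem tendstoInMeasure_tauHat_of_measurable (hZ : ∀ i, Measurable (Z i))
    (hX : ∀ i, Measurable (X i)) (h_indep : iIndepFun (fun i ω => (Z i ω, X i ω)) P)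
    (hfZ_meas : Measurable fZ) (hfZ_nonneg : ∀ z, 0 ≤ fZ z)
    [IsProbabilityMeasure (covLaw fZ)]
    (h_law : ∀ i, P.map (fun ω => (Z i ω, X i ω)) = Measure.compProd (covLaw fZ) κ)
    (h_margins : ∀ z t, κ z {x | x.1 = t} = 0 ∧ κ z {x | x.2 = t} = 0)
    (h_fpos : 0 < fZ z) (h_fcont : ContinuousAt fZ z)
    (h_taucont : ContinuousAt (fun q : Cov p × Cov p => condTauPair κ q.1 q.2) (z, z))
    (hK_meas : Measurable K) (hC : ∀ u, |K u| ≤ C) (hKint : Integrable K)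
    (hK1 : ∫ u, K u = 1)
    (hK_tail : Tendsto (fun t : Cov p => K t * ‖t‖ ^ p) (cocompact (Cov p)) (𝓝 0))
    (h_pos : ∀ n, 0 < h n) (h_zero : Tendsto h atTop (𝓝 0))
    (h_rate : Tendsto (fun n : ℕ => (n : ℝ) * h n ^ p) atTop atTop)
    (hg : g = gOne ∨ g = gTwo ∨ g = gThree) :
    TendstoInMeasure P (fun n ω => tauHat K (h n) g n (fun k => Z k ω) (fun k => X k ω) z) atTop
      fun _ => condKendallTau κ z := by
  have hKpos : 0 < ∫ u, |K u| := by
    have := abs_integral_le_integral_abs (f := K) (μ := volume)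
    rw [hK1, abs_one] at this
    linarith
  have hV := tendstoInMeasure_centredDoubleSum hZ hX h_indep hfZ_meas hfZ_nonneg h_law h_margins
    h_fcont h_taucont hK_meas hC hKpos hK_tail h_pos h_zero h_rate hg
  have hf := tendstoInMeasure_densityEstimator hZ (h_indep.comp (fun _ w => w.1) fun _ =>
    measurable_fst) hfZ_meas hfZ_nonneg (map_covariate_eq hX h_law) h_fcont hK_meas hC hKint
    hK1 hKpos hK_tail h_pos h_zero h_rate
  have hcont : ContinuousAt (fun q : ℝ × ℝ => (q.1 + condKendallTau κ z * q.2 ^ 2) / q.2 ^ 2)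
      (0, fZ z) := by
    refine ContinuousAt.div (by fun_prop) (by fun_prop) ?_
    exact pow_ne_zero 2 h_fpos.ne'
  have := (hV.prodMk_const hf).comp_continuousAt_const hcont
  simp only [zero_add, mul_div_cancel_right₀ _ (pow_ne_zero 2 h_fpos.ne')] at this
  refine this.congr_left fun n => ae_of_all _ fun ω => ?_
  exact (tauHat_eq_div K (h n) g n _ _ z _).symm

/-- Dilations and translations preserve Lebesgue-null sets. As `Z i` has a density, changing `K` on
a null set therefore alters the weights only on a `P`-null event. -/
theorem ae_scaledKernel_eq {K' : Cov p → ℝ} (hKK' : K' =ᵐ[volume] K) {b : ℝ} (hb : 0 < b)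
    (z : Cov p) : ∀ᵐ u, scaledKernel K' b (u - z) = scaledKernel K b (u - z) := by
  have h1 : ∀ᵐ u : Cov p, K' (b⁻¹ • u) = K (b⁻¹ • u) := by
    rw [ae_iff]
    have := Measure.addHaar_preimage_smul (volume : Measure (Cov p)) (inv_ne_zero hb.ne')
      {u | ¬ K' u = K u}
    rw [ae_iff.1 hKK', mul_zero] at this
    exact this
  have h2 := (measurePreserving_sub_right (volume : Measure (Cov p)) z).quasiMeasurePreserving.ae h1
  filter_upwards [h2] with u hu
  rw [scaledKernel, scaledKernel, hu]

/-- Consistency of the kernel estimator of the conditional Kendall's tau. -/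
theorem tendstoInMeasure_tauHat (hZ : ∀ i, Measurable (Z i))
    (hX : ∀ i, Measurable (X i)) (h_indep : iIndepFun (fun i ω => (Z i ω, X i ω)) P)
    (hfZ_meas : Measurable fZ) (hfZ_nonneg : ∀ z, 0 ≤ fZ z)
    (h_law : ∀ i, P.map (fun ω => (Z i ω, X i ω)) = Measure.compProd (covLaw fZ) κ)
    (h_margins : ∀ z t, κ z {x | x.1 = t} = 0 ∧ κ z {x | x.2 = t} = 0)
    (h_fpos : 0 < fZ z) (h_fcont : ContinuousAt fZ z)
    (h_taucont : ContinuousAt (fun q : Cov p × Cov p => condTauPair κ q.1 q.2) (z, z))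
    (hC : ∀ u, |K u| ≤ C) (hKint : Integrable K) (hK1 : ∫ u, K u = 1)
    (hK_tail : Tendsto (fun t : Cov p => K t * ‖t‖ ^ p) (cocompact (Cov p)) (𝓝 0))
    (h_pos : ∀ n, 0 < h n) (h_zero : Tendsto h atTop (𝓝 0))
    (h_rate : Tendsto (fun n : ℕ => (n : ℝ) * h n ^ p) atTop atTop)
    (hg : g = gOne ∨ g = gTwo ∨ g = gThree) :
    TendstoInMeasure P (fun n ω => tauHat K (h n) g n (fun k => Z k ω) (fun k => X k ω) z) atTop
      fun _ => condKendallTau κ z := by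
  have hprob : IsProbabilityMeasure (covLaw fZ) := by
    rw [← map_covariate_eq hX h_law 0]
    exact Measure.isProbabilityMeasure_map (hZ 0).aemeasurable
  -- Integrability gives only almost-everywhere measurability of `K`; the moment computations are
  -- run with a Borel version, and the estimator is transferred back almost surely.
  obtain ⟨K', hK'_meas, hK'_ae, hK'_le⟩ := exists_measurable_ae_eq_abs_le hKint
  have htail' : Tendsto (fun t : Cov p => K' t * ‖t‖ ^ p) (cocompact (Cov p)) (𝓝 0) := by
    refine squeeze_zero_norm (fun t => ?_) (tendsto_abs_mul_norm_pow hK_tail)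
    rw [norm_mul, Real.norm_eq_abs, norm_pow, norm_norm]
    exact mul_le_mul_of_nonneg_right (hK'_le t) (by positivity)
  have := tendstoInMeasure_tauHat_of_measurable (K := K') hZ hX h_indep hfZ_meas hfZ_nonneg h_law
    h_margins h_fpos h_fcont h_taucont hK'_meas (fun u => (hK'_le u).trans (hC u))
    (hKint.congr hK'_ae.symm) ((integral_congr_ae hK'_ae).trans hK1) htail' h_pos h_zero h_rate hg
  refine this.congr_left fun n => ?_
  have hae : ∀ i, ∀ᵐ ω ∂P, scaledKernel K' (h n) (Z i ω - z) = scaledKernel K (h n) (Z i ω - z) :=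
    fun i => by
      have h1 : ∀ᵐ u ∂(P.map (Z i)), scaledKernel K' (h n) (u - z) =
          scaledKernel K (h n) (u - z) := by
        rw [map_covariate_eq hX h_law i]
        exact (withDensity_absolutelyContinuous _ _).ae_le (ae_scaledKernel_eq hK'_ae (h_pos n) z)
      exact ae_of_ae_map (hZ i).aemeasurable h1
  filter_upwards [ae_all_iff.2 hae] with ω hω
  simp only [tauHat, kernelWeight, hω]

end Consistency

/-! ### The link function and the main theorem -/

theorem truncUnit_eq_self {t : ℝ} (ht : t ∈ Icc (-1 : ℝ) 1) : truncUnit t = t := by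
  rw [truncUnit, min_eq_right ht.2, max_eq_right ht.1]

/-- Truncation may produce an endpoint outside `D`, where `Λ` is arbitrary. Near `t` it reaches an
endpoint only if `t` is that endpoint, which then lies in `D`; so truncated values stay in `D` and
continuity on `D` suffices. -/
theorem continuousAt_comp_truncUnit {D : Set ℝ} (hD₁ : Ioo (-1) 1 ⊆ D) (hD₂ : D ⊆ Icc (-1) 1)
    {Λ : ℝ → ℝ} (hΛ : ContinuousOn Λ D) {t : ℝ} (ht : t ∈ D) :
    ContinuousAt (fun x => Λ (truncUnit x)) t := by
  have hc : Continuous truncUnit := by unfold truncUnit; fun_prop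
  have htt : truncUnit t = t := truncUnit_eq_self (hD₂ ht)
  have hmem : ∀ᶠ x in 𝓝 t, truncUnit x ∈ D := by
    have h1 : ∀ᶠ x in 𝓝 t, truncUnit x = 1 → t = 1 := by
      by_cases h : t = 1
      · exact Eventually.of_forall fun _ _ => h
      · filter_upwards [hc.continuousAt.eventually_ne (htt.trans_ne h)] with x hx hx'
        exact absurd hx' hx
    have h2 : ∀ᶠ x in 𝓝 t, truncUnit x = -1 → t = -1 := by
      by_cases h : t = -1
      · exact Eventually.of_forall fun _ _ => h
      · filter_upwards [hc.continuousAt.eventually_ne (htt.trans_ne h)] with x hx hx'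
        exact absurd hx' hx
    filter_upwards [h1, h2] with x hx1 hx2
    have hle : truncUnit x ≤ 1 := max_le (by norm_num) (min_le_left _ _)
    have hge : -1 ≤ truncUnit x := le_max_left _ _
    by_cases e1 : truncUnit x = 1
    · rw [e1, ← hx1 e1]; exact ht
    by_cases e2 : truncUnit x = -1
    · rw [e2, ← hx2 e2]; exact ht
    exact hD₁ ⟨lt_of_le_of_ne hge (Ne.symm e2), lt_of_le_of_ne hle e1⟩
  have hcw : ContinuousWithinAt Λ D (truncUnit t) := by rw [htt]; exact hΛ t ht
  exact hcw.tendsto.comp (tendsto_nhdsWithin_iff.2 ⟨hc.continuousAt, hmem⟩)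

theorem mainTheorem5
    {Ω : Type*} [MeasurableSpace Ω] (P : Measure Ω) [IsProbabilityMeasure P]
    {p p' n' : ℕ} (hn' : 0 < n')
    -- the i.i.d. sample `(X_i, Z_i)`, the density of `Z`, the conditional law `κ` of `X` given `Z`
    (Z : ℕ → Ω → Cov p) (X : ℕ → Ω → ℝ × ℝ)
    (hZ : ∀ i, Measurable (Z i)) (hX : ∀ i, Measurable (X i))
    (h_indep : iIndepFun (fun i ω => (Z i ω, X i ω)) P)
    (fZ : Cov p → ℝ) (hfZ_meas : Measurable fZ) (hfZ_nonneg : ∀ z, 0 ≤ fZ z)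
    (κ : Kernel (Cov p) (ℝ × ℝ)) [IsMarkovKernel κ]
    (h_law : ∀ i, P.map (fun ω => (Z i ω, X i ω)) =
      Measure.compProd (volume.withDensity fun z => ENNReal.ofReal (fZ z)) κ)
    -- the conditional margins are continuous
    (h_margins : ∀ z t, κ z {x | x.1 = t} = 0 ∧ κ z {x | x.2 = t} = 0)
    -- the compact set of covariate values of interest
    (S : Set (Cov p)) (hS : IsCompact S)
    (h_fmin : ∃ c : ℝ, 0 < c ∧ ∀ z ∈ S, c ≤ fZ z)
    (h_fcont : ∀ z ∈ S, ContinuousAt fZ z)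
    (h_taucont : ∀ z ∈ S,
      ContinuousAt (fun q : Cov p × Cov p => condTauPair κ q.1 q.2) (z, z))
    -- the kernel, the bandwidths, the choice of `g`
    (K : Cov p → ℝ) (α : ℕ) (hα : 1 < α) (hK : IsKernelOfOrder K α)
    (hK_tail : Tendsto (fun t : Cov p => K t * ‖t‖ ^ p) (cocompact (Cov p)) (𝓝 0))
    (h : ℕ → ℝ) (h_pos : ∀ n, 0 < h n) (h_zero : Tendsto h atTop (𝓝 0))
    (h_rate : Tendsto (fun n : ℕ => (n : ℝ) * h n ^ p) atTop atTop)
    (g : ℝ × ℝ → ℝ × ℝ → ℝ) (hg : g = gOne ∨ g = gTwo ∨ g = gThree)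
    -- the regression model
    (D : Set ℝ) (hD₁ : Ioo (-1) 1 ⊆ D) (hD₂ : D ⊆ Icc (-1) 1)
    (Λ : ℝ → ℝ) (hΛ_mono : StrictMonoOn Λ D) (hΛ_smooth : ContDiffOn ℝ 1 Λ D)
    (ψ : Cov p → Fin p' → ℝ) (βstar : Fin p' → ℝ)
    (h_model : ∀ z ∈ S, condKendallTau κ z ∈ D ∧ Λ (condKendallTau κ z) = ψ z ⬝ᵥ βstar)
    -- the fixed design points, the penalty levels, the estimator
    (z' : Fin n' → Cov p) (hz' : ∀ i, z' i ∈ S)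
    (lam : ℕ → ℝ) (h_lam : ∀ n, 0 ≤ lam n) (lam₀ : ℝ) (h_lam_lim : Tendsto lam atTop (𝓝 lam₀))
    (βhat : ℕ → Ω → Fin p' → ℝ)
    (h_βhat : ∀ n ω, IsMinOn
      (lassoCriterion ψ z'
        (fun i => Λ (truncUnit
          (tauHat K (h n) g n (fun k => Z k ω) (fun k => X k ω) (z' i)))) (lam n))
      univ (βhat n ω)) :
    (∀ βss : Fin p' → ℝ,
      (∀ β, β ≠ βss → limitCriterion ψ z' βstar lam₀ βss < limitCriterion ψ z' βstar lam₀ β) →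
      TendstoInMeasure P βhat atTop (fun _ => βss)) ∧
    (lam₀ = 0 → Submodule.span ℝ (range fun i => ψ (z' i)) = ⊤ →
      (∀ β, β ≠ βstar →
        limitCriterion ψ z' βstar lam₀ βstar < limitCriterion ψ z' βstar lam₀ β) ∧
      TendstoInMeasure P βhat atTop (fun _ => βstar)) := by
  have hconv : ∀ βss : Fin p' → ℝ,
      (∀ β, β ≠ βss → limitCriterion ψ z' βstar lam₀ βss < limitCriterion ψ z' βstar lam₀ β) →
      TendstoInMeasure P βhat atTop (fun _ => βss) := by
    intro βss hβss
    obtain ⟨C, hC⟩ := hK.bounded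
    obtain ⟨c, hc, hcS⟩ := h_fmin
    have htau := fun i => tendstoInMeasure_tauHat hZ hX h_indep hfZ_meas hfZ_nonneg h_law
      h_margins (hc.trans_le (hcS _ (hz' i))) (h_fcont _ (hz' i)) (h_taucont _ (hz' i)) hC
      hK.integrable hK.integral_eq_one hK_tail h_pos h_zero h_rate hg
    have hY := TendstoInMeasure.pi_const fun i => (htau i).comp_continuousAt_const
      (continuousAt_comp_truncUnit hD₁ hD₂ hΛ_smooth.continuousOn (h_model _ (hz' i)).1)
    have hlim : (fun i => Λ (truncUnit (condKendallTau κ (z' i)))) =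
        fun i => ψ (z' i) ⬝ᵥ βstar := funext fun i => by
      rw [truncUnit_eq_self (hD₂ (h_model _ (hz' i)).1), (h_model _ (hz' i)).2]
    rw [hlim, tendstoInMeasure_const_iff] at hY
    rw [tendstoInMeasure_iff_dist]
    intro ε hε
    rw [limitCriterion_eq_lassoCriterion] at hβss
    obtain ⟨U, hU, V, hV, hUV⟩ := mem_nhds_prod_iff.1
      (eventually_dist_lt_of_isMinOn_lassoCriterion hβss hε)
    refine tendsto_of_tendsto_of_tendsto_of_le_of_le' tendsto_const_nhds (hY U hU)
      (Eventually.of_forall fun _ => zero_le) ?_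
    filter_upwards [h_lam_lim hV] with n hn
    -- The bad event for `βhat` is contained in the event that the responses leave `U`. Monotonicity
    -- of the outer measure is enough, so no measurability of the chosen minimiser enters.
    refine measure_mono fun ω hω hmem => ?_
    exact not_lt.2 hω (hUV (mk_mem_prod hmem hn) (h_lam n) _ (h_βhat n ω))
  refine ⟨hconv, fun h_lam₀ hspan => ?_⟩
  subst h_lam₀
  have hlt := fun β (hβ : β ≠ βstar) => limitCriterion_zero_lt_of_span_eq_top hn' hspan hβ
  exact ⟨hlt, hconv βstar hlt⟩
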